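/- Let $k$ be a field, $G$ a finite group, $kG$ its group algebra, and $X\subseteq G$ a set of representatives of the conjugacy classes of $G$. For $x\in X$ let $C_x$ be the conjugacy class of $x$ and $C_G(x)$ its centralizer, and fix a right coset decomposition $G=\bigsqcup_{i=1}^{n_x}C_G(x)\gamma_{i,x}$ with $\gamma_{1,x}=1$; put $x_i=\gamma_{i,x}^{-1}x\gamma_{i,x}$, so $C_x=\{x_1,\dots,x_{n_x}\}$ and $x_1=x$. Write $\overline G=G\setminus\{1\}$ and let $\mathcal H^*$ be the normalized Hochschild complex of $kG$: $\mathcal H^n=\mathrm{Hom}_k((kG/k\cdot 1)^{\otimes n},kG)=\mathrm{Map}(\overline G^{\,n},kG)$, with $$\delta\varphi(g_1,\dots,g_{n+1})=g_1\varphi(g_2,\dots,g_{n+1})+\sum_{i=1}^n(-1)^i\varphi(\dots,g_ig_{i+1},\dots)+(-1)^{n+1}\varphi(g_1,\dots,g_n)g_{n+1},$$ whose cohomology is $HH^*(kG)$. Let $C^*(C_G(x),k)$ be the normalized complex $C^n=\mathrm{Map}(\overline{C_G(x)}^{\,n},k)$, where $\overline{C_G(x)}=C_G(x)\setminus\{1\}$,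 with $$\delta c(h_1,\dots,h_{n+1})=c(h_2,\dots,h_{n+1})+\sum_{i=1}^n(-1)^ic(\dots,h_ih_{i+1},\dots)+(-1)^{n+1}c(h_1,\dots,h_n),$$ whose cohomology is $H^*(C_G(x),k)$. In both complexes a cochain is understood to be $0$ as soon as one argument is $1$. Let $$\mathcal H_x^n=\{\varphi\in\mathcal H^n:\ \varphi(g_1,\dots,g_n)\in k[g_1\cdots g_nC_x]\ \text{for all } g_1,\dots,g_n\},$$ where $k[S]\subseteq kG$ is the subspace spanned by $S\subseteq G$ (so $\mathcal H_x^0=kC_x$). Then $\mathcal H^*$ and the $C^*(C_G(x),k)$ are cochain complexes, every $\mathcal H^*_x$ is a subcomplex of $\mathcal H^*$, and $\mathcal H^*=\bigoplus_{x\in X}\mathcal H_x^*$. For every $x\in X$ there are cochain maps, in both directions, between $\mathcal H_x^*$ and $C^*(C_G(x),k)$: (a) $\varphi_x\mapsto\widehat\varphi_x$, where $\widehat\varphi_x(h_1,\dots,h_n)$ is the coefficient of $x$ in $\varphi_x(h_1,\dots,h_n)h_n^{-1}\cdots h_1^{-1}$ for $h_1,\dots,h_n\in C_G(x)$; (b)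 $\widehat\varphi_x\mapsto\varphi_x$, where $$\varphi_x(g_1,\dots,g_n)=\sum_{i=1}^{n_x}\widehat\varphi_x(h_{i,1},\dots,h_{i,n})\,x_i\,g_1\cdots g_n,$$ and $h_{i,1},\dots,h_{i,n}\in C_G(x)$ are determined by $\gamma_{i,x}g_1=h_{i,1}\gamma_{s_i^1,x}$, $\gamma_{s_i^1,x}g_2=h_{i,2}\gamma_{s_i^2,x}$, …, $\gamma_{s_i^{n-1},x}g_n=h_{i,n}\gamma_{s_i^n,x}$. On cohomology these two maps induce mutually inverse $k$-linear isomorphisms $H^n(\mathcal H_x^*)\cong H^n(C_G(x),k)$ for every $n\ge 0$. Consequently, for every $n\ge0$ there is a $k$-linear isomorphism $$HH^n(kG)\;\xrightarrow{\ \sim\ }\;\bigoplus_{x\in X}H^n(C_G(x),k)$$ which sends the class of a cocycle $\varphi_x\in\mathcal H_x^n$ to $[\widehat\varphi_x]$ in the $x$-th summand, as in (a), and whose inverse sends a class $[\widehat\varphi_x]$ in the $x$-th summand to $[\varphi_x]\in HH^n(kG)$, as in (b). -/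

import Mathlib

open scoped DirectSum Pointwise

namespace GroupHH

/-! ### Cohomology of a graded family of submodules stable under a differential -/

section Cohomology

variable {k : Type*} [CommRing k] {M : ℕ → Type*} [∀ n, AddCommGroup (M n)]
  [∀ n, Module k (M n)]

/-- The `n`-cocycles of the complex `(C, d)`, where `C n` is a submodule of `M n`. -/
def cocycles (d : ∀ n, M n →ₗ[k] M (n + 1)) (C : ∀ n, Submodule k (M n)) (n : ℕ) :
    Submodule k (M n) :=
  C n ⊓ LinearMap.ker (d n)

/-- The `n`-coboundaries of the complex `(C, d)`: zero for `n = 0`, and `d (C n)` in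
degree `n + 1`. -/
def coboundaries (d : ∀ n, M n →ₗ[k] M (n + 1)) (C : ∀ n, Submodule k (M n)) :
    ∀ n, Submodule k (M n)
  | 0 => ⊥
  | n + 1 => (C n).map (d n)

/-- The `n`-th cohomology (cocycles modulo coboundaries) of the complex `(C, d)`. -/
abbrev Cohomology (d : ∀ n, M n →ₗ[k] M (n + 1)) (C : ∀ n, Submodule k (M n)) (n : ℕ) :
    Type _ :=
  cocycles d C n ⧸ (coboundaries d C n).submoduleOf (cocycles d C n)

/-- The cohomology class of a cocycle. -/
def cohomologyClass (d : ∀ n, M n →ₗ[k] M (n + 1)) (C : ∀ n, Submodule k (M n)) (n : ℕ)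
    (z : M n) (hz : z ∈ cocycles d C n) : Cohomology d C n :=
  Submodule.Quotient.mk ⟨z, hz⟩

/-- `(C, d)` is a cochain complex: `d` maps `C n` to `C (n + 1)`, and `d ∘ d = 0` on `C`. -/
def IsCochainComplex (d : ∀ n, M n →ₗ[k] M (n + 1)) (C : ∀ n, Submodule k (M n)) : Prop :=
  ∀ n, ∀ f ∈ C n, d n f ∈ C (n + 1) ∧ d (n + 1) (d n f) = 0

end Cohomology

/-! ### The normalized Hochschild complex of an algebra with coefficients in itself -/

section Hochschild

variable (k : Type*) [CommRing k] (A : Type*) [Ring A] [Algebra k A]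

/-- Multiplying two adjacent arguments and then changing one argument amounts to changing one
argument, linearly, of the contracted tuple. -/
theorem contractNth_update {n : ℕ} (i : Fin n) (p : Fin (n + 1)) (a : Fin (n + 1) → A) :
    ∃ (q : Fin n) (L : A →ₗ[k] A), ∀ v : A,
      Fin.contractNth i.castSucc (· * ·) (Function.update a p v) =
        Function.update (Fin.contractNth i.castSucc (· * ·) a) q (L v) := by
  rcases lt_trichotomy (p : ℕ) (i : ℕ) with h | h | h
  · refine ⟨⟨p, by omega⟩, LinearMap.id, fun v => ?_⟩
    funext j
    simp only [Fin.contractNth, Function.update_apply, Fin.ext_iff, Fin.val_castSucc,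
      Fin.val_succ, LinearMap.id_apply]
    grind
  · refine ⟨i, LinearMap.mulRight k (a i.succ), fun v => ?_⟩
    funext j
    simp only [Fin.contractNth, Function.update_apply, Fin.ext_iff, Fin.val_castSucc,
      Fin.val_succ, LinearMap.mulRight_apply]
    grind
  · by_cases h' : (p : ℕ) = i + 1
    · refine ⟨i, LinearMap.mulLeft k (a i.castSucc), fun v => ?_⟩
      funext j
      simp only [Fin.contractNth, Function.update_apply, Fin.ext_iff, Fin.val_castSucc,
        Fin.val_succ, LinearMap.mulLeft_apply]
      grind
    · refine ⟨⟨p - 1, by omega⟩, LinearMap.id, fun v => ?_⟩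
      funext j
      simp only [Fin.contractNth, Function.update_apply, Fin.ext_iff, Fin.val_castSucc,
        Fin.val_succ, LinearMap.id_apply]
      grind

variable {k A}

/-- `a₁ ⊗ ⋯ ⊗ aₙ₊₁ ↦ a₁ f(a₂, …, aₙ₊₁)`. -/
def hochFirst {n : ℕ} (f : MultilinearMap k (fun _ : Fin n => A) A) :
    MultilinearMap k (fun _ : Fin (n + 1) => A) A where
  toFun a := a 0 * f (Fin.tail a)
  map_update_add' := by
    intro _ a p x y
    obtain rfl := Subsingleton.elim ‹DecidableEq (Fin (n + 1))› (instDecidableEqFin _)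
    refine Fin.cases ?_ (fun p => ?_) p
    · simp [Fin.tail_update_zero, add_mul]
    · simp [Fin.tail_update_succ, mul_add, Function.update_of_ne (Fin.succ_ne_zero p).symm]
  map_update_smul' := by
    intro _ a p c x
    obtain rfl := Subsingleton.elim ‹DecidableEq (Fin (n + 1))› (instDecidableEqFin _)
    refine Fin.cases ?_ (fun p => ?_) p
    · simp [Fin.tail_update_zero]
    · simp [Fin.tail_update_succ, Function.update_of_ne (Fin.succ_ne_zero p).symm]

/-- `a₁ ⊗ ⋯ ⊗ aₙ₊₁ ↦ f(a₁, …, aᵢ aᵢ₊₁, …, aₙ₊₁)` (the index `i` is shifted by one here). -/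
def hochMiddle {n : ℕ} (f : MultilinearMap k (fun _ : Fin n => A) A) (i : Fin n) :
    MultilinearMap k (fun _ : Fin (n + 1) => A) A where
  toFun a := f (Fin.contractNth i.castSucc (· * ·) a)
  map_update_add' := by
    intro _ a p x y
    obtain rfl := Subsingleton.elim ‹DecidableEq (Fin (n + 1))› (instDecidableEqFin _)
    obtain ⟨q, L, h⟩ := contractNth_update k A i p a
    simp [h]
  map_update_smul' := by
    intro _ a p c x
    obtain rfl := Subsingleton.elim ‹DecidableEq (Fin (n + 1))› (instDecidableEqFin _)
    obtain ⟨q, L, h⟩ := contractNth_update k A i p a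
    simp [h]

/-- `a₁ ⊗ ⋯ ⊗ aₙ₊₁ ↦ f(a₁, …, aₙ) aₙ₊₁`. -/
def hochLast {n : ℕ} (f : MultilinearMap k (fun _ : Fin n => A) A) :
    MultilinearMap k (fun _ : Fin (n + 1) => A) A where
  toFun a := f (Fin.init a) * a (Fin.last n)
  map_update_add' := by
    intro _ a p x y
    obtain rfl := Subsingleton.elim ‹DecidableEq (Fin (n + 1))› (instDecidableEqFin _)
    refine Fin.lastCases ?_ (fun p => ?_) p
    · simp [Fin.init_update_last, mul_add]
    · simp [Fin.init_update_castSucc, add_mul,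
        Function.update_of_ne (Fin.castSucc_lt_last p).ne']
  map_update_smul' := by
    intro _ a p c x
    obtain rfl := Subsingleton.elim ‹DecidableEq (Fin (n + 1))› (instDecidableEqFin _)
    refine Fin.lastCases ?_ (fun p => ?_) p
    · simp [Fin.init_update_last]
    · simp [Fin.init_update_castSucc, Function.update_of_ne (Fin.castSucc_lt_last p).ne']

variable (k A)

/-- The Hochschild differential
`(δ f)(a₁, …, aₙ₊₁) = a₁ f(a₂, …, aₙ₊₁) + ∑ᵢ (-1)ⁱ f(a₁, …, aᵢ aᵢ₊₁, …, aₙ₊₁)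
  + (-1)ⁿ⁺¹ f(a₁, …, aₙ) aₙ₊₁`. -/
def hochD (n : ℕ) : MultilinearMap k (fun _ : Fin n => A) A →ₗ[k]
    MultilinearMap k (fun _ : Fin (n + 1) => A) A where
  toFun f := hochFirst f + ∑ i : Fin n, (-1 : k) ^ ((i : ℕ) + 1) • hochMiddle f i +
    (-1 : k) ^ (n + 1) • hochLast f
  map_add' f g := by
    ext a
    simp [hochFirst, hochMiddle, hochLast, mul_add, add_mul, Finset.sum_add_distrib]
    abel
  map_smul' c f := by
    ext a
    simp [hochFirst, hochMiddle, hochLast, Finset.smul_sum, smul_smul, mul_comm]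

theorem hochD_apply (n : ℕ) (f : MultilinearMap k (fun _ : Fin n => A) A)
    (a : Fin (n + 1) → A) :
    hochD k A n f a = a 0 * f (fun i => a i.succ) +
      ∑ i : Fin n, (-1 : k) ^ ((i : ℕ) + 1) • f (Fin.contractNth i.castSucc (· * ·) a) +
      (-1 : k) ^ (n + 1) • (f (fun i => a i.castSucc) * a (Fin.last n)) := by
  simp [hochD, hochFirst, hochMiddle, hochLast]
  rfl

/-- The normalized Hochschild `n`-cochains of `A`: the `k`-multilinear maps `Aⁿ → A` that vanish
as soon as one argument is `1`, that is, the linear maps `(A/k·1)^{⊗n} → A`. -/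
def hochC (n : ℕ) : Submodule k (MultilinearMap k (fun _ : Fin n => A) A) where
  carrier := {f | ∀ (a : Fin n → A) (i : Fin n), a i = 1 → f a = 0}
  add_mem' := by
    intro f g hf hg a i h
    simp [hf a i h, hg a i h]
  zero_mem' := by
    intro a i _
    simp
  smul_mem' := by
    intro c f hf a i h
    simp [hf a i h]

/-- The Hochschild cohomology `HHⁿ(A)`, computed by the normalized bar resolution. -/
abbrev HH (n : ℕ) : Type _ := Cohomology (hochD k A) (hochC k A) n

end Hochschild

/-! ### The normalized complex of a group with trivial coefficients -/

section GroupCohomology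

variable (k : Type*) [CommRing k] (H : Type*) [Group H]

/-- The differential `(δ f)(h₁, …, hₙ₊₁) = f(h₂, …, hₙ₊₁)
  + ∑ᵢ (-1)ⁱ f(h₁, …, hᵢ hᵢ₊₁, …, hₙ₊₁) + (-1)ⁿ⁺¹ f(h₁, …, hₙ)`. -/
def grpD (n : ℕ) : ((Fin n → H) → k) →ₗ[k] ((Fin (n + 1) → H) → k) where
  toFun f h := f (fun i => h i.succ) +
    ∑ i : Fin n, (-1 : k) ^ ((i : ℕ) + 1) * f (Fin.contractNth i.castSucc (· * ·) h) +
    (-1 : k) ^ (n + 1) * f (fun i => h i.castSucc)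
  map_add' f g := by
    funext h
    simp [mul_add, Finset.sum_add_distrib]
    ring
  map_smul' c f := by
    funext h
    simp [mul_add, Finset.mul_sum, mul_left_comm]

/-- The normalized `n`-cochains: the maps `Hⁿ → k` that vanish as soon as one argument is `1`,
that is, the maps `(H ∖ {1})ⁿ → k` extended by zero. -/
def grpC (n : ℕ) : Submodule k ((Fin n → H) → k) where
  carrier := {f | ∀ (h : Fin n → H) (i : Fin n), h i = 1 → f h = 0}
  add_mem' := by
    intro f g hf hg h i hi
    simp [hf h i hi, hg h i hi]
  zero_mem' := by
    intro h i _
    simp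
  smul_mem' := by
    intro c f hf h i hi
    simp [hf h i hi]

/-- The group cohomology `Hⁿ(H, k)` with trivial coefficients, computed by the normalized bar
resolution. -/
abbrev GrpH (n : ℕ) : Type _ := Cohomology (grpD k H) (grpC k H) n

end GroupCohomology

/-! ### The subcomplexes attached to conjugacy classes, and the comparison maps -/

section Realization

variable (k : Type*) [Field k] {G : Type*} [Group G]

/-- The tuple of basis elements of `kG` given by a tuple of group elements. -/
noncomputable def ofTuple {n : ℕ} (g : Fin n → G) : Fin n → MonoidAlgebra k G :=
  fun i => MonoidAlgebra.of k G (g i)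

/-- The Cibils–Solotar cochains `H_xⁿ`: the normalized Hochschild cochains `φ` of `kG` with
`φ(g₁, …, gₙ) ∈ k[g₁ ⋯ gₙ C_x]` for all `gᵢ ∈ G`, `C_x` being the conjugacy class of `x`. -/
noncomputable def csC (x : G) (n : ℕ) : Submodule k
    (MultilinearMap k (fun _ : Fin n => MonoidAlgebra k G) (MonoidAlgebra k G)) where
  carrier := {φ | φ ∈ hochC k (MonoidAlgebra k G) n ∧ ∀ g : Fin n → G,
    φ (ofTuple k g) ∈
      Submodule.span k (MonoidAlgebra.of k G '' ((List.ofFn g).prod • conjugatesOf x))}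
  add_mem' := fun hf hg =>
    ⟨Submodule.add_mem _ hf.1 hg.1, fun g => Submodule.add_mem _ (hf.2 g) (hg.2 g)⟩
  zero_mem' := ⟨Submodule.zero_mem _, fun _ => Submodule.zero_mem _⟩
  smul_mem' := fun c _ hf =>
    ⟨Submodule.smul_mem _ c hf.1, fun g => Submodule.smul_mem _ c (hf.2 g)⟩

/-- The cohomology `Hⁿ(H_x^*)` of the Cibils–Solotar complex. -/
abbrev CSH (x : G) (n : ℕ) : Type _ :=
  Cohomology (hochD k (MonoidAlgebra k G)) (csC k x) n

/-- The map `φ ↦ φ̂`, where `φ̂(h₁, …, hₙ)` is the coefficient of `x` in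
`φ(h₁, …, hₙ) hₙ⁻¹ ⋯ h₁⁻¹` for `h₁, …, hₙ` in the centralizer of `x`. -/
noncomputable def hatMap (x : G) (n : ℕ) :
    MultilinearMap k (fun _ : Fin n => MonoidAlgebra k G) (MonoidAlgebra k G) →ₗ[k]
      ((Fin n → Subgroup.centralizer {x}) → k) where
  toFun φ h := (φ (ofTuple k fun i => (h i : G)) *
    MonoidAlgebra.of k G (List.ofFn fun i => (h i : G)).prod⁻¹).coeff x
  map_add' φ ψ := by
    funext h
    simp [add_mul]
  map_smul' c φ := by
    funext h
    simp

/-- A decomposition `G = H γ₀ ⊔ ⋯ ⊔ H γₘ` into right cosets with `γ₀ = 1`. -/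
structure RightTransversal (H : Subgroup G) where
  /-- The number of cosets other than `H`. -/
  m : ℕ
  /-- The representatives. -/
  γ : Fin (m + 1) → G
  γ_zero : γ 0 = 1
  bij : Function.Bijective (fun p : H × Fin (m + 1) => (p.1 : G) * γ p.2)

namespace RightTransversal

variable {H : Subgroup G} (T : RightTransversal H)

/-- The unique `(h, s)` with `g = h γ_s`. -/
noncomputable def split (g : G) : H × Fin (T.m + 1) :=
  (Equiv.ofBijective _ T.bij).symm g

theorem split_spec (g : G) : ((T.split g).1 : G) * T.γ (T.split g).2 = g :=
  (Equiv.ofBijective _ T.bij).apply_symm_apply g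

/-- The indices `s_i^0 = i, s_i^1, …, s_i^n` attached to `γ_i` and `g₁, …, gₙ`. -/
noncomputable def idx {n : ℕ} (i : Fin (T.m + 1)) (g : Fin n → G) :
    Fin (n + 1) → Fin (T.m + 1) :=
  Fin.induction i (fun j s => (T.split (T.γ s * g j)).2)

/-- The elements `h_{i,1}, …, h_{i,n}` of `H` attached to `γ_i` and `g₁, …, gₙ`. -/
noncomputable def elt {n : ℕ} (i : Fin (T.m + 1)) (g : Fin n → G) : Fin n → H :=
  fun j => (T.split (T.γ (T.idx i g j.castSucc) * g j)).1

theorem idx_zero {n : ℕ} (i : Fin (T.m + 1)) (g : Fin n → G) : T.idx i g 0 = i := rfl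

/-- The defining recursion `γ_{s_i^{j-1}} g_j = h_{i,j} γ_{s_i^j}`. -/
theorem elt_spec {n : ℕ} (i : Fin (T.m + 1)) (g : Fin n → G) (j : Fin n) :
    T.γ (T.idx i g j.castSucc) * g j = (T.elt i g j : G) * T.γ (T.idx i g j.succ) := by
  have h : T.idx i g j.succ = (T.split (T.γ (T.idx i g j.castSucc) * g j)).2 := by
    simp [idx, Fin.induction_succ]
  rw [h, elt, split_spec]

end RightTransversal

variable [Fintype G]

open Classical in
/-- The multilinear extension to `kG` of a map `Gⁿ → kG`. -/
noncomputable def extend {n : ℕ} (F : (Fin n → G) → MonoidAlgebra k G) :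
    MultilinearMap k (fun _ : Fin n => MonoidAlgebra k G) (MonoidAlgebra k G) :=
  ∑ g : Fin n → G, ((MultilinearMap.mkPiAlgebra k (Fin n) k).compLinearMap
    fun i => (Finsupp.lapply (g i)).comp
      (MonoidAlgebra.coeffLinearEquiv k).toLinearMap).smulRight (F g)

theorem extend_ofTuple {n : ℕ} (F : (Fin n → G) → MonoidAlgebra k G) (g : Fin n → G) :
    extend k F (ofTuple k g) = F g := by
  classical
  simp only [extend, sum_apply]
  rw [Finset.sum_eq_single g]
  · simp [ofTuple]
  · intro g' _ hg'
    obtain ⟨i, hi⟩ := Function.ne_iff.mp hg'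
    simp only [MultilinearMap.smulRight_apply, MultilinearMap.compLinearMap_apply,
      MultilinearMap.mkPiAlgebra_apply]
    rw [Finset.prod_eq_zero (Finset.mem_univ i), zero_smul]
    simp [ofTuple, Ne.symm hi]
  · simp

/-- The value `∑ᵢ c(h_{i,1}, …, h_{i,n}) xᵢ g₁ ⋯ gₙ` at `(g₁, …, gₙ)` of the cochain attached to
`c`, with `xᵢ = γᵢ⁻¹ x γᵢ`. -/
noncomputable def liftVal {x : G} (T : RightTransversal (Subgroup.centralizer {x})) {n : ℕ}
    (c : (Fin n → Subgroup.centralizer {x}) → k) (g : Fin n → G) : MonoidAlgebra k G :=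
  ∑ i : Fin (T.m + 1), c (T.elt i g) •
    MonoidAlgebra.of k G ((T.γ i)⁻¹ * x * T.γ i * (List.ofFn g).prod)

/-- The map `c ↦ φ`, where `φ(g₁, …, gₙ) = ∑ᵢ c(h_{i,1}, …, h_{i,n}) xᵢ g₁ ⋯ gₙ` on elements
of `G`. -/
noncomputable def liftMap {x : G} (T : RightTransversal (Subgroup.centralizer {x})) (n : ℕ)
    (c : (Fin n → Subgroup.centralizer {x}) → k) :
    MultilinearMap k (fun _ : Fin n => MonoidAlgebra k G) (MonoidAlgebra k G) :=
  extend k (liftVal k T c)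

theorem liftMap_ofTuple {x : G} (T : RightTransversal (Subgroup.centralizer {x})) (n : ℕ)
    (c : (Fin n → Subgroup.centralizer {x}) → k) (g : Fin n → G) :
    liftMap k T n c (ofTuple k g) = ∑ i : Fin (T.m + 1), c (T.elt i g) •
      MonoidAlgebra.of k G ((T.γ i)⁻¹ * x * T.γ i * (List.ofFn g).prod) :=
  extend_ofTuple k _ g

end Realization

end GroupHH

open GroupHH

/-! Describe a Hochschild cochain φ by its coordinates F(y; g₁, …, gₙ), the coefficient of y g₁⋯gₙ
in φ(g₁, …, gₙ). In these coordinates the Hochschild differential moves y only in its first term, to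
g₁⁻¹ y g₁ (`coeff_hochD`). Conjugacy classes therefore never mix, which gives the decomposition, and
the part attached to x is the bar complex of G with coefficients in the functions on C_x ≅ C_G(x)\G
(`coeffMap_hochD`).

What remains is Shapiro's lemma for H = C_G(x), made explicit on normalized cochains. A cochain with
values in the functions on H\G is the same as an H-invariant function of vertices u₀, …, uₙ in G,
the differential being the alternating sum over deleted vertices. The transversal provides an
H-equivariant retraction r : G → H, hγ_s ↦ h. Map (b) is pullback along r, because the h_{i,j} are
the successive quotients of the projected vertices (`elt_eq_steps`); map (a) restricts to vertices
in H. Hence (a) after (b) is the identity on cochains, and (b) after (a) is pullback along r viewed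
as a map G → G (`inflate_restrict`). The prism operator is a homotopy between the latter and the
identity (`prism_altD`). It preserves invariance and normalization (`leftInvariant_prism`,
`Normalized.prism`), so it stays inside the complex. -/

namespace GroupHH

/-! ### Homogeneous cochains on the simplices with vertices in a type -/

section Homogeneous

variable {k : Type*} [CommRing k] {V : Type*}

/-- The simplicial coboundary of a function of `n` vertices. -/
def altD {n : ℕ} (f : (Fin n → V) → k) (u : Fin (n + 1) → V) : k :=
  ∑ j : Fin (n + 1), (-1 : k) ^ (j : ℕ) * f (fun i => u (j.succAbove i))

theorem altD_zero {n : ℕ} : altD (0 : (Fin n → V) → k) = 0 := by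
  funext u
  simp [altD]

theorem altD_sub {n : ℕ} (f g : (Fin n → V) → k) : altD (f - g) = altD f - altD g := by
  funext u
  simp [altD, mul_sub]

/-- Deleting the first vertex gives the first term; every other deletion keeps a and shifts the
sign. This recursion replaces all double sums over faces by inductions on the number of vertices. -/
theorem altD_cons {n : ℕ} (f : (Fin (n + 1) → V) → k) (a : V) (u : Fin (n + 1) → V) :
    altD f (Fin.cons a u) = f u - altD (fun v => f (Fin.cons a v)) u := by
  have h (j : Fin (n + 1)) : (fun i => (Fin.cons a u : Fin (n + 2) → V) (j.succ.succAbove i)) =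
      Fin.cons a (fun i => u (j.succAbove i)) := by
    funext i
    refine Fin.cases ?_ (fun i => ?_) i <;> simp
  rw [altD, Fin.sum_univ_succ]
  simp only [h, altD, sub_eq_add_neg, ← Finset.sum_neg_distrib]
  simp [pow_succ]

/-- With first vertex a fixed and f_a = f(a, ·), two uses of `altD_cons` reduce the value at (a, u)
to that of `altD (altD f_a)` at u. -/
theorem altD_altD {n : ℕ} (f : (Fin n → V) → k) : altD (altD f) = 0 := by
  induction n with
  | zero =>
    funext u
    simp only [altD]
    simp only [Subsingleton.elim (fun i : Fin 0 => _) (Fin.elim0 : Fin 0 → V)]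
    simp
  | succ n ih =>
    funext u
    rw [← Fin.cons_self_tail u, altD_cons]
    have : (fun v => altD f (Fin.cons (u 0) v)) = f - altD (fun v => f (Fin.cons (u 0) v)) := by
      funext v
      simp [altD_cons]
    rw [this, altD_sub, ih]
    simp

/-- A function of `n + 1` vertices is normalized if it vanishes on tuples with two equal
consecutive vertices. -/
def Normalized {n : ℕ} (f : (Fin (n + 1) → V) → k) : Prop :=
  ∀ (u : Fin (n + 1) → V) (i : Fin n), u i.castSucc = u i.succ → f u = 0

theorem Normalized.cons {n : ℕ} {f : (Fin (n + 2) → V) → k} (hf : Normalized f) (a : V) :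
    Normalized (fun v => f (Fin.cons a v)) := fun u i hi => hf _ i.succ (by simpa using hi)

theorem Normalized.cons_cons {n : ℕ} {f : (Fin (n + 2) → V) → k} (hf : Normalized f) (a : V)
    (u : Fin n → V) : f (Fin.cons a (Fin.cons a u)) = 0 := hf _ 0 rfl

theorem Normalized.altD {n : ℕ} {f : (Fin (n + 1) → V) → k} (hf : Normalized f) :
    Normalized (altD f) := by
  induction n with
  | zero =>
    intro u i hi
    have hu : ∀ i, u i = u 0 := by
      intro j
      fin_cases i
      fin_cases j
      · rfl
      · exact hi.symm
    simp [GroupHH.altD, Fin.sum_univ_two, hu]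
  | succ n ih =>
    intro u i hi
    obtain ⟨a, v, rfl⟩ : ∃ a v, u = Fin.cons a v := ⟨u 0, Fin.tail u, (Fin.cons_self_tail u).symm⟩
    rw [altD_cons]
    obtain rfl | ⟨i, rfl⟩ := Fin.eq_zero_or_eq_succ i
    · obtain ⟨b, w, rfl⟩ : ∃ b w, v = Fin.cons b w :=
        ⟨v 0, Fin.tail v, (Fin.cons_self_tail v).symm⟩
      obtain rfl : a = b := hi
      rw [altD_cons]
      -- Expanding twice, the two values f(a, w) cancel, and what is left is the coboundary of f
      -- with a inserted twice, a zero function.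
      have : (fun v => f (Fin.cons a (Fin.cons a v))) = 0 := by
        funext v
        exact hf.cons_cons a v
      rw [this, altD_zero]
      simp
    · have hi' : v i.castSucc = v i.succ := by simpa using hi
      rw [hf v i hi', ih (hf.cons a) v i hi', sub_zero]

/-- The prism operator between the identity and the map of simplices induced by a map `r` of
the vertices: the alternating sum of the values at
`(r u₀, …, r uⱼ, uⱼ, …, uₙ)`. -/
def prism (r : V → V) : ∀ n : ℕ, ((Fin (n + 1) → V) → k) → (Fin n → V) → k
  | 0, _, _ => 0
  | n + 1, f, u => f (Fin.cons (r (u 0)) u) -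
      prism r n (fun v => f (Fin.cons (r (u 0)) v)) (Fin.tail u)

variable (r : V → V)

theorem prism_cons {n : ℕ} (f : (Fin (n + 2) → V) → k) (a : V) (u : Fin n → V) :
    prism r (n + 1) f (Fin.cons a u) = f (Fin.cons (r a) (Fin.cons a u)) -
      prism r n (fun v => f (Fin.cons (r a) v)) u := rfl

theorem prism_zero (n : ℕ) : prism r n (0 : (Fin (n + 1) → V) → k) = 0 := by
  induction n with
  | zero => rfl
  | succ n ih =>
    funext u
    change 0 - prism r n 0 (Fin.tail u) = 0
    simp [ih]

theorem prism_sub (n : ℕ) (f g : (Fin (n + 1) → V) → k) :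
    prism r n (f - g) = prism r n f - prism r n g := by
  induction n with
  | zero => simp [prism, funext_iff]
  | succ n ih =>
    funext u
    have := congrFun (ih (fun v => f (Fin.cons (r (u 0)) v)) (fun v => g (Fin.cons (r (u 0)) v)))
      (Fin.tail u)
    simp only [Pi.sub_apply] at this ⊢
    change f _ - g _ - prism r n ((fun v => f (Fin.cons (r (u 0)) v)) -
      (fun v => g (Fin.cons (r (u 0)) v))) (Fin.tail u) = _
    rw [this]
    simp only [prism]
    ring

/-- The usual prism homotopy: inner faces cancel and only the two ends of the prism survive. In the
induction both summands are expanded at the first vertex a, leaving the same identity for f(r a, ·).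
-/
theorem prism_altD (n : ℕ) (f : (Fin (n + 1) → V) → k) :
    prism r (n + 1) (altD f) + altD (prism r n f) = f - fun u => f (r ∘ u) := by
  induction n with
  | zero =>
    funext u
    obtain ⟨a, v, rfl⟩ : ∃ a v, u = Fin.cons a v := ⟨u 0, Fin.tail u, (Fin.cons_self_tail u).symm⟩
    have h (w : Fin 0 → V) : r ∘ (Fin.cons a w : Fin 1 → V) = Fin.cons (r a) w := by
      funext i
      fin_cases i
      simp
    have h0 : prism r 0 f = 0 := rfl
    rw [h0, altD_zero, add_zero, prism_cons, altD_cons]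
    simp only [prism, Pi.sub_apply, h]
    simp only [altD]
    simp only [Subsingleton.elim (fun i : Fin 0 => _) (v : Fin 0 → V)]
    simp
  | succ n ih =>
    funext u
    obtain ⟨a, v, rfl⟩ : ∃ a v, u = Fin.cons a v := ⟨u 0, Fin.tail u, (Fin.cons_self_tail u).symm⟩
    have h : r ∘ (Fin.cons a v : Fin (n + 2) → V) = Fin.cons (r a) (r ∘ v) := by
      funext i
      refine Fin.cases ?_ (fun i => ?_) i <;> simp
    have h1 : (fun v => altD f (Fin.cons (r a) v)) = f - altD (fun v => f (Fin.cons (r a) v)) := by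
      funext v
      simp [altD_cons]
    have h2 : (fun w => prism r (n + 1) f (Fin.cons a w)) =
        (fun w => f (Fin.cons (r a) (Fin.cons a w))) -
          prism r n (fun v => f (Fin.cons (r a) v)) := by
      funext w
      simp [prism_cons]
    have h3 := congrFun (ih (fun v => f (Fin.cons (r a) v))) v
    simp only [Pi.sub_apply, Pi.add_apply] at h3 ⊢
    rw [prism_cons, altD_cons, altD_cons, altD_cons, h, h1, h2, altD_sub, prism_sub]
    simp only [Pi.sub_apply]
    linear_combination h3

/-- If uᵢ = uᵢ₊₁, each tuple (r u₀, …, r uⱼ, uⱼ, …) still has two equal neighbours: the repetition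
survives after the jump when j ≤ i and, through r, before it when j > i. -/
theorem Normalized.prism {n : ℕ} {f : (Fin (n + 2) → V) → k} (hf : Normalized f) :
    Normalized (prism r (n + 1) f) := by
  induction n with
  | zero => exact fun _ i => i.elim0
  | succ n ih =>
    intro u i hi
    obtain ⟨a, v, rfl⟩ : ∃ a v, u = Fin.cons a v := ⟨u 0, Fin.tail u, (Fin.cons_self_tail u).symm⟩
    rw [prism_cons]
    obtain rfl | ⟨i, rfl⟩ := Fin.eq_zero_or_eq_succ i
    · obtain ⟨b, w, rfl⟩ : ∃ b w, v = Fin.cons b w :=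
        ⟨v 0, Fin.tail v, (Fin.cons_self_tail v).symm⟩
      obtain rfl : a = b := hi
      have : (fun v => f (Fin.cons (r a) (Fin.cons (r a) v))) = 0 := by
        funext v
        exact hf.cons_cons _ v
      rw [prism_cons, hf.cons_cons, this, prism_zero, (hf.cons _).cons_cons]
      simp
    · have hi' : v i.castSucc = v i.succ := by simpa using hi
      rw [hf _ i.succ.succ (by simpa using hi'), ih (hf.cons _) v i hi', sub_zero]

end Homogeneous

/-! ### Inhomogeneous cochains of groups and of transversals -/

section Bar

variable {k : Type*} [CommRing k] {G : Type*} [Group G]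

/-- The elements `uᵢ⁻¹ uᵢ₊₁` attached to group elements `u₀, …, uₙ`. -/
def steps {n : ℕ} (u : Fin (n + 1) → G) : Fin n → G := fun i => (u i.castSucc)⁻¹ * u i.succ

theorem steps_mul_partialProd {n : ℕ} (a : G) (g : Fin n → G) :
    steps (fun i => a * Fin.partialProd g i) = g := by
  funext i
  simp [steps, Fin.partialProd_succ, mul_assoc]

theorem steps_partialProd {n : ℕ} (g : Fin n → G) : steps (Fin.partialProd g) = g := by
  simpa using steps_mul_partialProd 1 g

theorem steps_mul_left {n : ℕ} (a : G) (u : Fin (n + 1) → G) :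
    steps (fun i => a * u i) = steps u := by
  funext i
  simp [steps, mul_assoc]

theorem mul_partialProd_steps {n : ℕ} (u : Fin (n + 1) → G) :
    (fun i => u 0 * Fin.partialProd (steps u) i) = u :=
  Fin.partialProd_left_inv u

/-- For the vertices a, a g₁, a g₁g₂, …, deleting an inner vertex multiplies two neighbouring
arguments, deleting the last vertex drops the last argument, and deleting the first moves the base
point to a g₁. -/
theorem altD_mul_partialProd {n : ℕ} (f : (Fin (n + 1) → G) → k) (a : G)
    (g : Fin (n + 1) → G) :
    altD f (fun i => a * Fin.partialProd g i) =
      f (fun i => a * g 0 * Fin.partialProd (fun i => g i.succ) i) +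
      ∑ i : Fin n, (-1 : k) ^ ((i : ℕ) + 1) *
        f (fun j => a * Fin.partialProd (Fin.contractNth i.castSucc (· * ·) g) j) +
      (-1 : k) ^ (n + 1) * f (fun j => a * Fin.partialProd (fun i => g i.castSucc) j) := by
  rw [altD, Fin.sum_univ_succ, Fin.sum_univ_castSucc, ← add_assoc]
  congr 1
  · congr 1
    · simp only [Fin.val_zero, pow_zero, one_mul, Fin.zero_succAbove, Fin.partialProd_succ',
        mul_assoc]
      rfl
    · simp [Fin.partialProd_contractNth]
  · have h (j : Fin (n + 1)) : Fin.partialProd (fun i => g i.castSucc) j =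
        Fin.partialProd g j.castSucc := Fin.partialProd_init j
    simp [h]

theorem altD_comp_steps {n : ℕ} (c : (Fin n → G) → k) (u : Fin (n + 2) → G) :
    altD (fun u => c (steps u)) u = grpD k G n c (steps u) := by
  rw [← mul_partialProd_steps u, altD_mul_partialProd]
  simp only [steps_mul_partialProd]
  rfl

theorem grpD_eq_altD {n : ℕ} (c : (Fin n → G) → k) (g : Fin (n + 1) → G) :
    grpD k G n c g = altD (fun u => c (steps u)) (Fin.partialProd g) := by
  rw [altD_comp_steps, steps_partialProd]

theorem grpD_grpD {n : ℕ} (c : (Fin n → G) → k) : grpD k G (n + 1) (grpD k G n c) = 0 := by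
  funext g
  have : (fun u => grpD k G n c (steps u)) = altD (fun u => c (steps u)) :=
    funext fun u => (altD_comp_steps c u).symm
  rw [grpD_eq_altD, this, altD_altD]
  rfl

theorem grpD_mem {n : ℕ} {c : (Fin n → G) → k} (hc : c ∈ grpC k G n) :
    grpD k G n c ∈ grpC k G (n + 1) := by
  have h : Normalized (fun u => c (steps u)) :=
    fun u i hi => hc _ i (by simp [steps, hi])
  intro g i hi
  rw [grpD_eq_altD]
  exact h.altD _ i (by simp [Fin.partialProd_succ, hi])

theorem isCochainComplex_grp : IsCochainComplex (grpD k G) (grpC k G) :=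
  fun _ c hc => ⟨grpD_mem hc, grpD_grpD c⟩

end Bar

/-! ### Shapiro's lemma for a subgroup with a right transversal -/

namespace RightTransversal

variable {k : Type*} [CommRing k] {G : Type*} [Group G] {H : Subgroup G} (T : RightTransversal H)

theorem split_mul_γ (h : H) (s : Fin (T.m + 1)) : T.split (h * T.γ s) = (h, s) :=
  (Equiv.ofBijective _ T.bij).symm_apply_apply (h, s)

theorem split_γ (s : Fin (T.m + 1)) : T.split (T.γ s) = (1, s) := by
  simpa using T.split_mul_γ 1 s

/-- The first component is the retraction r, equivariant for left translation by H; the second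
depends only on the coset. -/
theorem split_mul (h : H) (g : G) : T.split (h * g) = (h * (T.split g).1, (T.split g).2) := by
  conv_lhs => rw [← T.split_spec g, ← mul_assoc, ← Subgroup.coe_mul, split_mul_γ]

theorem split_coe (h : H) : T.split h = (h, 0) := by
  simpa [T.γ_zero] using T.split_mul_γ h 0

/-- The right action of `G` on the indices of the cosets. -/
noncomputable def act (s : Fin (T.m + 1)) (g : G) : Fin (T.m + 1) := (T.split (T.γ s * g)).2

theorem γ_mul (s : Fin (T.m + 1)) (g : G) :
    T.γ s * g = ((T.split (T.γ s * g)).1 : G) * T.γ (T.act s g) :=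
  (T.split_spec _).symm

theorem γ_mul_partialProd {n : ℕ} (s : Fin (T.m + 1)) (g : Fin n → G) (i : Fin (n + 1)) :
    T.γ s * Fin.partialProd g i =
      ((Fin.partialProd (T.elt s g) i : H) : G) * T.γ (T.idx s g i) := by
  induction i using Fin.induction with
  | zero => simp [T.idx_zero]
  | succ i ih =>
    rw [Fin.partialProd_succ, ← mul_assoc, ih, mul_assoc, T.elt_spec, Fin.partialProd_succ,
      Subgroup.coe_mul, mul_assoc]

theorem split_γ_mul_partialProd {n : ℕ} (s : Fin (T.m + 1)) (g : Fin n → G) (i : Fin (n + 1)) :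
    T.split (T.γ s * Fin.partialProd g i) = (Fin.partialProd (T.elt s g) i, T.idx s g i) := by
  rw [γ_mul_partialProd, split_mul_γ]

/-- The recursion defining the h_{i,j} telescopes along γ_s, γ_s g₁, γ_s g₁g₂, …, so their partial
products are the projections of these vertices to H. -/
theorem elt_eq_steps {n : ℕ} (s : Fin (T.m + 1)) (g : Fin n → G) :
    T.elt s g = steps (fun i => (T.split (T.γ s * Fin.partialProd g i)).1) := by
  simp only [split_γ_mul_partialProd]
  exact (steps_partialProd _).symm

theorem elt_eq_one {n : ℕ} (s : Fin (T.m + 1)) (g : Fin n → G) (i : Fin n) (hi : g i = 1) :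
    T.elt s g i = 1 := by
  simp [elt_eq_steps, steps, Fin.partialProd_succ, hi]

theorem elt_zero_coe {n : ℕ} (h : Fin n → H) : T.elt 0 (fun i => (h i : G)) = h := by
  have (i : Fin (n + 1)) : Fin.partialProd (fun i => (h i : G)) i = (Fin.partialProd h i : H) := by
    induction i using Fin.induction with
    | zero => simp
    | succ i ih => simp [Fin.partialProd_succ, ih]
  simp only [elt_eq_steps, T.γ_zero, one_mul, this, split_coe]
  exact steps_partialProd _

/-- The differential of the inhomogeneous cochains of `G` with values in the functions on the
cosets of `H`. -/
noncomputable def cosetD {n : ℕ} (F : Fin (T.m + 1) → (Fin n → G) → k) :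
    Fin (T.m + 1) → (Fin (n + 1) → G) → k := fun s g =>
  F (T.act s (g 0)) (fun i => g i.succ) +
    ∑ i : Fin n, (-1 : k) ^ ((i : ℕ) + 1) * F s (Fin.contractNth i.castSucc (· * ·) g) +
    (-1 : k) ^ (n + 1) * F s (fun i => g i.castSucc)

/-- The homogeneous cochain attached to an inhomogeneous one. -/
noncomputable def toHomogeneous {n : ℕ} (F : Fin (T.m + 1) → (Fin n → G) → k)
    (u : Fin (n + 1) → G) : k :=
  F (T.split (u 0)).2 (steps u)

/-- The inhomogeneous cochain attached to a homogeneous one. -/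
def ofHomogeneous {n : ℕ} (f : (Fin (n + 1) → G) → k) : Fin (T.m + 1) → (Fin n → G) → k :=
  fun s g => f (fun i => T.γ s * Fin.partialProd g i)

omit [CommRing k] in
theorem ofHomogeneous_toHomogeneous {n : ℕ} (F : Fin (T.m + 1) → (Fin n → G) → k) :
    T.ofHomogeneous (T.toHomogeneous F) = F := by
  funext s g
  simp [ofHomogeneous, toHomogeneous, steps_mul_partialProd, split_γ]

theorem ofHomogeneous_sub {n : ℕ} (f f' : (Fin (n + 1) → G) → k) :
    T.ofHomogeneous (f - f') = T.ofHomogeneous f - T.ofHomogeneous f' := rfl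

/-- Invariance of a homogeneous cochain under the translations by `H`. -/
def _root_.GroupHH.LeftInvariant (H : Subgroup G) {n : ℕ} (f : (Fin n → G) → k) : Prop :=
  ∀ (h : H) (u : Fin n → G), f (fun i => h * u i) = f u

omit [CommRing k] in
theorem leftInvariant_toHomogeneous {n : ℕ} (F : Fin (T.m + 1) → (Fin n → G) → k) :
    LeftInvariant H (T.toHomogeneous F) := by
  intro h u
  simp [toHomogeneous, split_mul, steps_mul_left]

omit [CommRing k] in
theorem toHomogeneous_ofHomogeneous {n : ℕ} {f : (Fin (n + 1) → G) → k}
    (hf : LeftInvariant H f) : T.toHomogeneous (T.ofHomogeneous f) = f := by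
  funext u
  -- Writing u₀ = hγ_s, invariance moves the base vertex to γ_s.
  conv_rhs => rw [← mul_partialProd_steps u, ← T.split_spec (u 0)]
  simp only [mul_assoc]
  rw [hf]
  rfl

theorem _root_.GroupHH.LeftInvariant.altD {n : ℕ} {f : (Fin n → G) → k}
    (hf : LeftInvariant H f) : LeftInvariant H (altD f) := by
  intro h u
  simp only [GroupHH.altD]
  exact Finset.sum_congr rfl fun j _ => by rw [hf h]

theorem leftInvariant_prism (n : ℕ) {f : (Fin (n + 1) → G) → k}
    (hf : LeftInvariant H f) :
    LeftInvariant H (prism (fun g => ((T.split g).1 : G)) n f) := by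
  intro h u
  -- The recursion freezes the vertex r(u₀), which is itself translated by h. The frozen functions
  -- on the two sides differ, so the induction needs a pair f, f'.
  have key : ∀ (n : ℕ) (f f' : (Fin (n + 1) → G) → k)
      (_ : ∀ u, f (fun i => h * u i) = f' u) (u : Fin n → G),
      prism (fun g => ((T.split g).1 : G)) n f (fun i => h * u i) =
        prism (fun g => ((T.split g).1 : G)) n f' u := by
    intro n
    induction n with
    | zero => intros; rfl
    | succ n ih =>
      intro f f' hff u
      have hc (m : ℕ) (a : G) (u : Fin m → G) :
          (Fin.cons ((h : G) * a) (fun i => h * u i) : Fin (m + 1) → G) =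
            fun i => h * (Fin.cons a u : Fin (m + 1) → G) i := by
        funext i
        refine Fin.cases ?_ (fun i => ?_) i <;> simp
      simp only [prism, split_mul, Subgroup.coe_mul]
      rw [hc, hff]
      congr 1
      exact ih _ _ (fun v => by rw [hc, hff]) (Fin.tail u)
  exact key n f f (hf h) u

/-- Only the face deleting the first vertex changes the base point: γ_s g₁ = hγ_t with t the
translated index, and invariance removes h. -/
theorem cosetD_ofHomogeneous {n : ℕ} {f : (Fin (n + 1) → G) → k} (hf : LeftInvariant H f) :
    T.cosetD (T.ofHomogeneous f) = T.ofHomogeneous (altD f) := by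
  funext s g
  simp only [cosetD, ofHomogeneous, altD_mul_partialProd]
  rw [T.γ_mul]
  simp only [mul_assoc]
  rw [hf]

theorem cosetD_eq {n : ℕ} (F : Fin (T.m + 1) → (Fin n → G) → k) :
    T.cosetD F = T.ofHomogeneous (altD (T.toHomogeneous F)) := by
  rw [← cosetD_ofHomogeneous _ (T.leftInvariant_toHomogeneous F), ofHomogeneous_toHomogeneous]

theorem toHomogeneous_cosetD {n : ℕ} (F : Fin (T.m + 1) → (Fin n → G) → k) :
    T.toHomogeneous (T.cosetD F) = altD (T.toHomogeneous F) := by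
  rw [cosetD_eq, toHomogeneous_ofHomogeneous _ (T.leftInvariant_toHomogeneous F).altD]

theorem cosetD_cosetD {n : ℕ} (F : Fin (T.m + 1) → (Fin n → G) → k) :
    T.cosetD (T.cosetD F) = 0 := by
  rw [cosetD_eq, toHomogeneous_cosetD, altD_altD]
  rfl

/-- The normalized inhomogeneous cochains. -/
def _root_.GroupHH.VanishesAtOne {S : Type*} {n : ℕ} (F : S → (Fin n → G) → k) : Prop :=
  ∀ s g i, g i = 1 → F s g = 0

theorem normalized_toHomogeneous {n : ℕ} {F : Fin (T.m + 1) → (Fin n → G) → k}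
    (hF : VanishesAtOne F) : Normalized (T.toHomogeneous F) :=
  fun u i hi => hF _ _ i (by simp [steps, hi])

theorem vanishesAtOne_ofHomogeneous {n : ℕ} {f : (Fin (n + 1) → G) → k} (hf : Normalized f) :
    VanishesAtOne (T.ofHomogeneous f) :=
  fun s g i hi => hf _ i (by simp [Fin.partialProd_succ, hi])

theorem vanishesAtOne_cosetD {n : ℕ} {F : Fin (T.m + 1) → (Fin n → G) → k}
    (hF : VanishesAtOne F) : VanishesAtOne (T.cosetD F) := by
  rw [cosetD_eq]
  exact T.vanishesAtOne_ofHomogeneous (T.normalized_toHomogeneous hF).altD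

/-- The inhomogeneous cochain of `G` attached to a cochain of `H`. -/
noncomputable def inflate {n : ℕ} (c : (Fin n → H) → k) : Fin (T.m + 1) → (Fin n → G) → k :=
  fun s g => c (T.elt s g)

omit [CommRing k] in
theorem inflate_eq {n : ℕ} (c : (Fin n → H) → k) :
    T.inflate c = T.ofHomogeneous (fun u => c (steps fun i => (T.split (u i)).1)) := by
  funext s g
  simp [inflate, elt_eq_steps, ofHomogeneous]

theorem vanishesAtOne_inflate {n : ℕ} {c : (Fin n → H) → k} (hc : c ∈ grpC k H n) :
    VanishesAtOne (T.inflate c) :=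
  fun s g i hi => hc _ i (T.elt_eq_one s g i hi)

theorem cosetD_inflate {n : ℕ} (c : (Fin n → H) → k) :
    T.cosetD (T.inflate c) = T.inflate (grpD k H n c) := by
  rw [inflate_eq, cosetD_ofHomogeneous, inflate_eq]
  · congr 1
    funext u
    rw [← altD_comp_steps]
    rfl
  · intro h u
    simp [split_mul, steps_mul_left]

/-- The restriction to `H` of an inhomogeneous cochain. -/
def restrict {n : ℕ} (F : Fin (T.m + 1) → (Fin n → G) → k) : (Fin n → H) → k :=
  fun h => F 0 (fun i => (h i : G))

omit [CommRing k] in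
theorem restrict_inflate {n : ℕ} (c : (Fin n → H) → k) : T.restrict (T.inflate c) = c := by
  funext h
  simp [restrict, inflate, elt_zero_coe]

theorem restrict_cosetD {n : ℕ} (F : Fin (T.m + 1) → (Fin n → G) → k) :
    T.restrict (T.cosetD F) = grpD k H n (T.restrict F) := by
  funext h
  have h0 : T.act 0 (h 0 : G) = 0 := by simp [act, T.γ_zero, split_coe]
  have h1 (i : Fin n) : (Fin.contractNth i.castSucc (· * ·) fun i => (h i : G)) =
      fun j => ((Fin.contractNth i.castSucc (· * ·) h j : H) : G) :=
    (Fin.comp_contractNth (· * ·) (· * ·) (f := Subgroup.subtype H) (fun _ _ => rfl) _ h).symm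
  simp only [restrict, cosetD, h0, h1]
  rfl

omit [CommRing k] in
theorem inflate_restrict {n : ℕ} (F : Fin (T.m + 1) → (Fin n → G) → k) :
    T.inflate (T.restrict F) =
      T.ofHomogeneous (fun u => T.toHomogeneous F ((fun g => ((T.split g).1 : G)) ∘ u)) := by
  funext s g
  simp only [inflate, restrict, ofHomogeneous, toHomogeneous, Function.comp_apply, split_coe,
    elt_eq_steps]
  rfl

/-- In degree 0 the prism operator vanishes, so the homotopy formula gives an equality of cochains;
this matches the zero coboundaries there. -/
theorem inflate_restrict_zero {F : Fin (T.m + 1) → (Fin 0 → G) → k} (hF : T.cosetD F = 0) :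
    T.inflate (T.restrict F) = F := by
  have h := prism_altD (fun g => ((T.split g).1 : G)) 0 (T.toHomogeneous F)
  have h0 : T.toHomogeneous (0 : Fin (T.m + 1) → (Fin 1 → G) → k) = 0 := rfl
  rw [← toHomogeneous_cosetD, hF, h0, prism_zero] at h
  have h1 : prism (fun g => ((T.split g).1 : G)) 0 (T.toHomogeneous F) = 0 := rfl
  rw [h1, altD_zero, add_zero, eq_comm, sub_eq_zero] at h
  rw [inflate_restrict, ← h, ofHomogeneous_toHomogeneous]

theorem sub_inflate_restrict {n : ℕ} {F : Fin (T.m + 1) → (Fin (n + 1) → G) → k}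
    (hv : VanishesAtOne F) (hF : T.cosetD F = 0) :
    ∃ E : Fin (T.m + 1) → (Fin n → G) → k, VanishesAtOne E ∧
      F - T.inflate (T.restrict F) = T.cosetD E := by
  refine ⟨T.ofHomogeneous (prism (fun g => ((T.split g).1 : G)) (n + 1) (T.toHomogeneous F)),
    T.vanishesAtOne_ofHomogeneous ((T.normalized_toHomogeneous hv).prism _), ?_⟩
  have h := prism_altD (fun g => ((T.split g).1 : G)) (n + 1) (T.toHomogeneous F)
  have h0 : T.toHomogeneous (0 : Fin (T.m + 1) → (Fin (n + 2) → G) → k) = 0 := rfl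
  rw [← toHomogeneous_cosetD, hF, h0, prism_zero, zero_add] at h
  rw [cosetD_ofHomogeneous _ (T.leftInvariant_prism _ (T.leftInvariant_toHomogeneous F)), h,
    inflate_restrict]
  rw [ofHomogeneous_sub, ofHomogeneous_toHomogeneous]

end RightTransversal

/-! ### Hochschild cochains of a group algebra and their coefficients -/

section Coefficients

variable {k : Type*} [Field k] {G : Type*} [Group G]

theorem prod_ofFn_eq_partialProd {n : ℕ} (g : Fin n → G) :
    (List.ofFn g).prod = Fin.partialProd g (Fin.last n) := by
  simp [Fin.partialProd, List.take_of_length_le]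

theorem prod_ofFn_contractNth {n : ℕ} (g : Fin (n + 1) → G) (i : Fin n) :
    (List.ofFn (Fin.contractNth i.castSucc (· * ·) g)).prod = (List.ofFn g).prod := by
  simp only [prod_ofFn_eq_partialProd, Fin.partialProd_contractNth, Function.comp_apply]
  congr 1
  rw [Fin.succAbove_of_le_castSucc, Fin.succ_last]
  simp [Fin.le_def]

theorem prod_ofFn_succ (n : ℕ) (g : Fin (n + 1) → G) :
    (List.ofFn g).prod = g 0 * (List.ofFn fun i => g i.succ).prod := by
  simp [List.ofFn_succ]

theorem prod_ofFn_succ_last (n : ℕ) (g : Fin (n + 1) → G) :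
    (List.ofFn g).prod = (List.ofFn fun i => g i.castSucc).prod * g (Fin.last n) := by
  simp only [prod_ofFn_eq_partialProd, ← Fin.succ_last, Fin.partialProd_succ]
  rw [← Fin.partialProd_init]
  rfl

theorem ofTuple_contractNth {n : ℕ} (g : Fin (n + 1) → G) (i : Fin n) :
    Fin.contractNth i.castSucc (· * ·) (ofTuple k g) =
      ofTuple k (Fin.contractNth i.castSucc (· * ·) g) :=
  (Fin.comp_contractNth (· * ·) (· * ·) (f := MonoidAlgebra.of k G) (map_mul _) _ g).symm

/-- Measuring coefficients relative to the product g₁⋯gₙ₊₁ absorbs right multiplication by the last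
argument, and inner faces keep the product. Left multiplication by the first argument leaves a
conjugation of y. -/
theorem coeff_hochD {n : ℕ}
    (φ : MultilinearMap k (fun _ : Fin n => MonoidAlgebra k G) (MonoidAlgebra k G)) (y : G)
    (g : Fin (n + 1) → G) :
    (hochD k (MonoidAlgebra k G) n φ (ofTuple k g)).coeff (y * (List.ofFn g).prod) =
      (φ (ofTuple k fun i => g i.succ)).coeff
        ((g 0)⁻¹ * y * g 0 * (List.ofFn fun i => g i.succ).prod) +
      ∑ i : Fin n, (-1 : k) ^ ((i : ℕ) + 1) *
        (φ (ofTuple k (Fin.contractNth i.castSucc (· * ·) g))).coeff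
          (y * (List.ofFn (Fin.contractNth i.castSucc (· * ·) g)).prod) +
      (-1 : k) ^ (n + 1) * (φ (ofTuple k fun i => g i.castSucc)).coeff
        (y * (List.ofFn fun i => g i.castSucc).prod) := by
  rw [hochD_apply]
  simp only [MonoidAlgebra.coeff_add, MonoidAlgebra.coeff_sum, MonoidAlgebra.coeff_smul,
    Finsupp.add_apply, Finsupp.finsetSum_apply, Finsupp.smul_apply, smul_eq_mul,
    ofTuple_contractNth, prod_ofFn_contractNth]
  congr 1
  · congr 1
    change (MonoidAlgebra.single (g 0) 1 * φ (ofTuple k fun i => g i.succ)).coeff _ = _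
    rw [MonoidAlgebra.coeff_single_mul_apply, prod_ofFn_succ, one_mul]
    simp only [mul_assoc]
  · congr 1
    change (φ (ofTuple k fun i => g i.castSucc) *
      MonoidAlgebra.single (g (Fin.last n)) 1).coeff _ = _
    rw [MonoidAlgebra.coeff_mul_single_apply, prod_ofFn_succ_last, mul_one]
    simp only [mul_assoc, mul_inv_cancel, mul_one]

theorem mem_span_of_image {S : Set G} {a : MonoidAlgebra k G} :
    a ∈ Submodule.span k (MonoidAlgebra.of k G '' S) ↔ ∀ y, y ∉ S → a.coeff y = 0 := by
  constructor
  · intro h y hy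
    induction h using Submodule.span_induction with
    | mem b hb =>
      obtain ⟨z, hz, rfl⟩ := hb
      have : z ≠ y := fun e => hy (e ▸ hz)
      simp [this]
    | zero => simp
    | add b c _ _ hb hc => simp [hb, hc]
    | smul r b _ hb => simp [hb]
  · intro h
    rw [← MonoidAlgebra.sum_coeff_single a]
    refine Submodule.sum_mem _ fun y hy => ?_
    have hyS : y ∈ S := by
      by_contra hyS
      exact Finsupp.mem_support_iff.mp hy (h y hyS)
    have : MonoidAlgebra.single y (a.coeff y) = a.coeff y • MonoidAlgebra.of k G y := by
      simp
    rw [this]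
    exact Submodule.smul_mem _ _ (Submodule.subset_span ⟨y, hyS, rfl⟩)

theorem mul_mem_smul_conjugatesOf (x y p : G) :
    y * p ∈ p • conjugatesOf x ↔ IsConj x y := by
  rw [Set.mem_smul_set_iff_inv_smul_mem, smul_eq_mul]
  have : IsConj y (p⁻¹ * (y * p)) := isConj_iff.mpr ⟨p⁻¹, by group⟩
  exact ⟨fun h => h.trans this.symm, fun h => h.trans this⟩

theorem mem_csC_iff {x : G} {n : ℕ}
    {φ : MultilinearMap k (fun _ : Fin n => MonoidAlgebra k G) (MonoidAlgebra k G)} :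
    φ ∈ csC k x n ↔ φ ∈ hochC k (MonoidAlgebra k G) n ∧
      ∀ (y : G) (g : Fin n → G), ¬ IsConj x y →
        (φ (ofTuple k g)).coeff (y * (List.ofFn g).prod) = 0 := by
  refine and_congr_right fun _ => ⟨fun h y g hy => ?_, fun h g => ?_⟩
  · exact mem_span_of_image.mp (h g) _ (by rwa [mul_mem_smul_conjugatesOf])
  · refine mem_span_of_image.mpr fun y hy => ?_
    have := h (y * (List.ofFn g).prod⁻¹) g (by
      rw [← mul_mem_smul_conjugatesOf x _ (List.ofFn g).prod]
      simpa using hy)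
    simpa using this

variable [Fintype G]

theorem extend_of_ofTuple {n : ℕ}
    (φ : MultilinearMap k (fun _ : Fin n => MonoidAlgebra k G) (MonoidAlgebra k G)) :
    extend k (fun g => φ (ofTuple k g)) = φ :=
  Module.Basis.ext_multilinear
    (fun _ => (Finsupp.basisSingleOne (R := k) (ι := G)).map
      (MonoidAlgebra.coeffLinearEquiv k).symm) fun g => by
    have : (fun i => ((Finsupp.basisSingleOne (R := k) (ι := G)).map
        (MonoidAlgebra.coeffLinearEquiv k).symm) (g i)) = ofTuple k g := by
      funext i
      simp [ofTuple]
    rw [this, extend_ofTuple]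

theorem ext_coeff {n : ℕ}
    {φ ψ : MultilinearMap k (fun _ : Fin n => MonoidAlgebra k G) (MonoidAlgebra k G)}
    (h : ∀ (y : G) (g : Fin n → G), (φ (ofTuple k g)).coeff (y * (List.ofFn g).prod) =
      (ψ (ofTuple k g)).coeff (y * (List.ofFn g).prod)) : φ = ψ := by
  rw [← extend_of_ofTuple φ, ← extend_of_ofTuple ψ]
  congr 1
  funext g
  ext y
  simpa using h (y * (List.ofFn g).prod⁻¹) g

/-- Normalization may be tested on group elements because 1 is itself a basis vector of kG: an
argument equal to 1 kills every other basis tuple in the expansion. -/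
theorem mem_hochC_iff {n : ℕ}
    {φ : MultilinearMap k (fun _ : Fin n => MonoidAlgebra k G) (MonoidAlgebra k G)} :
    φ ∈ hochC k (MonoidAlgebra k G) n ↔
      ∀ (y : G) (g : Fin n → G) (i : Fin n), g i = 1 →
        (φ (ofTuple k g)).coeff (y * (List.ofFn g).prod) = 0 := by
  classical
  constructor
  · intro h y g i hi
    rw [h (ofTuple k g) i (by rw [ofTuple, hi, map_one])]
    simp
  · intro h a i hi
    rw [← extend_of_ofTuple φ]
    simp only [extend, sum_apply]
    refine Finset.sum_eq_zero fun g _ => ?_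
    simp only [MultilinearMap.smulRight_apply, MultilinearMap.compLinearMap_apply,
      MultilinearMap.mkPiAlgebra_apply]
    by_cases hg : g i = 1
    · have : φ (ofTuple k g) = 0 := by
        ext y
        simpa using h (y * (List.ofFn g).prod⁻¹) g i hg
      rw [this, smul_zero]
    · rw [Finset.prod_eq_zero (Finset.mem_univ i), zero_smul]
      have : a i = MonoidAlgebra.single 1 1 := hi
      simp [this, Ne.symm hg]

end Coefficients

/-! ### Hochschild cochains supported on a conjugacy class -/

section Support

variable {k : Type*} [Field k] {G : Type*} [Group G] {x : G}
  (T : RightTransversal (Subgroup.centralizer {x}))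

/-- The conjugate `γₛ⁻¹ x γₛ`. -/
def RightTransversal.conj (s : Fin (T.m + 1)) : G := (T.γ s)⁻¹ * x * T.γ s

theorem conj_coe_mul {x : G} (h : Subgroup.centralizer {x}) (g : G) :
    ((h : G) * g)⁻¹ * x * (h * g) = g⁻¹ * x * g := by
  have : (h : G) * x = x * h := (Subgroup.mem_centralizer_singleton_iff.mp h.2)
  calc ((h : G) * g)⁻¹ * x * (h * g) = g⁻¹ * (h : G)⁻¹ * (x * h) * g := by group
    _ = g⁻¹ * x * g := by rw [← this]; group

theorem RightTransversal.conj_act (s : Fin (T.m + 1)) (g : G) :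
    T.conj (T.act s g) = g⁻¹ * T.conj s * g := by
  have h : g⁻¹ * T.conj s * g = (T.γ s * g)⁻¹ * x * (T.γ s * g) := by
    simp [conj]; group
  rw [h, T.γ_mul, conj_coe_mul]
  rfl

theorem RightTransversal.conj_zero : T.conj 0 = x := by simp [conj, T.γ_zero]

theorem RightTransversal.isConj_conj (s : Fin (T.m + 1)) : IsConj x (T.conj s) :=
  isConj_iff.mpr ⟨(T.γ s)⁻¹, by simp [conj]⟩

theorem RightTransversal.exists_conj_eq {y : G} (h : IsConj x y) : ∃ s, T.conj s = y := by
  obtain ⟨c, rfl⟩ := isConj_iff.mp h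
  refine ⟨(T.split c⁻¹).2, ?_⟩
  rw [conj, ← conj_coe_mul (T.split c⁻¹).1, T.split_spec]
  simp

/-- Orbit–stabilizer: two representatives giving the same conjugate differ by an element of the
centralizer, hence lie in one coset. -/
theorem RightTransversal.conj_injective : Function.Injective T.conj := by
  intro s t h
  have hmem : T.γ t * (T.γ s)⁻¹ ∈ Subgroup.centralizer {x} := by
    rw [Subgroup.mem_centralizer_singleton_iff]
    simp only [conj] at h
    calc T.γ t * (T.γ s)⁻¹ * x = T.γ t * ((T.γ s)⁻¹ * x * T.γ s) * (T.γ s)⁻¹ := by group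
      _ = x * (T.γ t * (T.γ s)⁻¹) := by rw [h]; group
  have h1 := T.split_mul_γ ⟨_, hmem⟩ s
  simp only [inv_mul_cancel_right, T.split_γ] at h1
  exact (congrArg Prod.snd h1).symm

/-- The coefficients of a Hochschild cochain along the conjugacy class of `x`. -/
noncomputable def coeffMap {n : ℕ}
    (φ : MultilinearMap k (fun _ : Fin n => MonoidAlgebra k G) (MonoidAlgebra k G)) :
    Fin (T.m + 1) → (Fin n → G) → k :=
  fun s g => (φ (ofTuple k g)).coeff (T.conj s * (List.ofFn g).prod)

theorem coeffMap_hochD {n : ℕ}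
    (φ : MultilinearMap k (fun _ : Fin n => MonoidAlgebra k G) (MonoidAlgebra k G)) :
    coeffMap T (hochD k (MonoidAlgebra k G) n φ) = T.cosetD (coeffMap T φ) := by
  funext s g
  simp only [coeffMap, coeff_hochD, RightTransversal.cosetD, T.conj_act]

theorem hatMap_eq {n : ℕ}
    (φ : MultilinearMap k (fun _ : Fin n => MonoidAlgebra k G) (MonoidAlgebra k G)) :
    hatMap k x n φ = T.restrict (coeffMap T φ) := by
  funext h
  change (φ (ofTuple k fun i => (h i : G)) *
    MonoidAlgebra.single (List.ofFn fun i => (h i : G)).prod⁻¹ 1).coeff x = _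
  rw [MonoidAlgebra.coeff_mul_single_apply, RightTransversal.restrict, coeffMap, T.conj_zero]
  simp

theorem hatMap_hochD (T : RightTransversal (Subgroup.centralizer {x})) {n : ℕ}
    (φ : MultilinearMap k (fun _ : Fin n => MonoidAlgebra k G) (MonoidAlgebra k G)) :
    hatMap k x (n + 1) (hochD k (MonoidAlgebra k G) n φ) =
      grpD k (Subgroup.centralizer {x}) n (hatMap k x n φ) := by
  rw [hatMap_eq T, coeffMap_hochD, T.restrict_cosetD, hatMap_eq T]

variable [Fintype G]

theorem vanishesAtOne_coeffMap {n : ℕ}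
    {φ : MultilinearMap k (fun _ : Fin n => MonoidAlgebra k G) (MonoidAlgebra k G)}
    (hφ : φ ∈ hochC k (MonoidAlgebra k G) n) : VanishesAtOne (coeffMap T φ) :=
  fun _ g i hi => mem_hochC_iff.mp hφ _ g i hi

omit [Fintype G] in
theorem coeffMap_eq_zero {z : G} (hz : ¬ IsConj z x) {n : ℕ}
    {φ : MultilinearMap k (fun _ : Fin n => MonoidAlgebra k G) (MonoidAlgebra k G)}
    (hφ : φ ∈ csC k z n) : coeffMap T φ = 0 := by
  funext s g
  exact (mem_csC_iff.mp hφ).2 _ g fun h => hz (h.trans (T.isConj_conj s).symm)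

theorem hatMap_mem (T : RightTransversal (Subgroup.centralizer {x})) {n : ℕ}
    {φ : MultilinearMap k (fun _ : Fin n => MonoidAlgebra k G) (MonoidAlgebra k G)}
    (hφ : φ ∈ hochC k (MonoidAlgebra k G) n) :
    hatMap k x n φ ∈ grpC k (Subgroup.centralizer {x}) n := by
  intro h i hi
  rw [hatMap_eq T]
  exact vanishesAtOne_coeffMap T hφ _ _ i (by simp [hi])

/-- The Hochschild cochain `(g₁, …, gₙ) ↦ ∑ₛ F(s; g₁, …, gₙ) xₛ g₁ ⋯ gₙ`. -/
noncomputable def ofCoeffMap {n : ℕ} (F : Fin (T.m + 1) → (Fin n → G) → k) :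
    MultilinearMap k (fun _ : Fin n => MonoidAlgebra k G) (MonoidAlgebra k G) :=
  extend k fun g => ∑ s, F s g • MonoidAlgebra.of k G (T.conj s * (List.ofFn g).prod)

theorem liftMap_eq {n : ℕ} (c : (Fin n → Subgroup.centralizer {x}) → k) :
    liftMap k T n c = ofCoeffMap T (T.inflate c) := rfl

theorem coeffMap_ofCoeffMap {n : ℕ} (F : Fin (T.m + 1) → (Fin n → G) → k) :
    coeffMap T (ofCoeffMap T F) = F := by
  classical
  funext s g
  simp [coeffMap, ofCoeffMap, extend_ofTuple, MonoidAlgebra.coeff_sum, Finsupp.single_apply,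
    T.conj_injective.eq_iff]

theorem ofCoeffMap_mem {n : ℕ} {F : Fin (T.m + 1) → (Fin n → G) → k} (hF : VanishesAtOne F) :
    ofCoeffMap T F ∈ csC k x n := by
  classical
  refine mem_csC_iff.mpr ⟨mem_hochC_iff.mpr fun y g i hi => ?_, fun y g hy => ?_⟩
  · simp [ofCoeffMap, extend_ofTuple, hF _ g i hi]
  · have (s : Fin (T.m + 1)) : T.conj s ≠ y := fun h => hy (h ▸ T.isConj_conj s)
    simp [ofCoeffMap, extend_ofTuple, MonoidAlgebra.coeff_sum, this]

/-- Coordinates outside the class of x vanish on both sides. Identities in the subcomplex can thus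
be checked on coset cochains. -/
theorem eq_of_coeffMap_eq {n : ℕ}
    {φ ψ : MultilinearMap k (fun _ : Fin n => MonoidAlgebra k G) (MonoidAlgebra k G)}
    (hφ : φ ∈ csC k x n) (hψ : ψ ∈ csC k x n) (h : coeffMap T φ = coeffMap T ψ) : φ = ψ := by
  refine ext_coeff fun y g => ?_
  by_cases hy : IsConj x y
  · obtain ⟨s, rfl⟩ := T.exists_conj_eq hy
    exact congrFun (congrFun h s) g
  · rw [(mem_csC_iff.mp hφ).2 y g hy, (mem_csC_iff.mp hψ).2 y g hy]

theorem hochD_mem_csC (T : RightTransversal (Subgroup.centralizer {x})) {n : ℕ}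
    {φ : MultilinearMap k (fun _ : Fin n => MonoidAlgebra k G) (MonoidAlgebra k G)}
    (hφ : φ ∈ csC k x n) : hochD k (MonoidAlgebra k G) n φ ∈ csC k x (n + 1) := by
  have hs (y : G) (g : Fin (n + 1) → G) (hy : ¬ IsConj x y) :
      (hochD k (MonoidAlgebra k G) n φ (ofTuple k g)).coeff (y * (List.ofFn g).prod) = 0 := by
    have h0 : ¬ IsConj x ((g 0)⁻¹ * y * g 0) := fun h =>
      hy (h.trans (isConj_iff.mpr ⟨g 0, by group⟩))
    rw [coeff_hochD, (mem_csC_iff.mp hφ).2 _ _ h0]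
    simp [(mem_csC_iff.mp hφ).2 _ _ hy]
  refine mem_csC_iff.mpr ⟨mem_hochC_iff.mpr fun y g i hi => ?_, hs⟩
  -- On the class of x, normalization is inherited from `cosetD`; elsewhere all coordinates vanish
  -- already.
  by_cases hy : IsConj x y
  · obtain ⟨s, rfl⟩ := T.exists_conj_eq hy
    have := T.vanishesAtOne_cosetD (vanishesAtOne_coeffMap T hφ.1) s g i hi
    rwa [← coeffMap_hochD] at this
  · exact hs y g hy

theorem hochD_ofCoeffMap {n : ℕ} {F : Fin (T.m + 1) → (Fin n → G) → k} (hF : VanishesAtOne F) :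
    hochD k (MonoidAlgebra k G) n (ofCoeffMap T F) = ofCoeffMap T (T.cosetD F) := by
  refine eq_of_coeffMap_eq T (hochD_mem_csC T (ofCoeffMap_mem T hF))
    (ofCoeffMap_mem T (T.vanishesAtOne_cosetD hF)) ?_
  rw [coeffMap_hochD, coeffMap_ofCoeffMap, coeffMap_ofCoeffMap]

theorem isCochainComplex_csC (T : RightTransversal (Subgroup.centralizer {x})) :
    IsCochainComplex (hochD k (MonoidAlgebra k G)) (csC k x) := by
  refine fun n φ hφ => ⟨hochD_mem_csC T hφ, eq_of_coeffMap_eq T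
    (hochD_mem_csC T (hochD_mem_csC T hφ)) (Submodule.zero_mem _) ?_⟩
  rw [coeffMap_hochD, coeffMap_hochD, T.cosetD_cosetD]
  rfl

theorem liftMap_mem {n : ℕ} {c : (Fin n → Subgroup.centralizer {x}) → k}
    (hc : c ∈ grpC k (Subgroup.centralizer {x}) n) : liftMap k T n c ∈ csC k x n :=
  ofCoeffMap_mem T (T.vanishesAtOne_inflate hc)

theorem liftMap_grpD {n : ℕ} {c : (Fin n → Subgroup.centralizer {x}) → k}
    (hc : c ∈ grpC k (Subgroup.centralizer {x}) n) :
    liftMap k T (n + 1) (grpD k (Subgroup.centralizer {x}) n c) =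
      hochD k (MonoidAlgebra k G) n (liftMap k T n c) := by
  rw [liftMap_eq, liftMap_eq, hochD_ofCoeffMap T (T.vanishesAtOne_inflate hc), T.cosetD_inflate]

theorem hatMap_liftMap {n : ℕ} (c : (Fin n → Subgroup.centralizer {x}) → k) :
    hatMap k x n (liftMap k T n c) = c := by
  rw [hatMap_eq T, liftMap_eq, coeffMap_ofCoeffMap, T.restrict_inflate]

/-- `liftMap` is a plain function; preserving 0 is all the linearity that the passage to cocycles
and coboundaries requires. -/
theorem liftMap_zero (n : ℕ) :
    liftMap k T n (0 : (Fin n → Subgroup.centralizer {x}) → k) = 0 := by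
  refine eq_of_coeffMap_eq T (liftMap_mem T (Submodule.zero_mem _)) (Submodule.zero_mem _) ?_
  rw [liftMap_eq, coeffMap_ofCoeffMap]
  rfl

theorem sub_liftMap_hatMap_mem {n : ℕ}
    {φ : MultilinearMap k (fun _ : Fin n => MonoidAlgebra k G) (MonoidAlgebra k G)}
    (hφ : φ ∈ cocycles (hochD k (MonoidAlgebra k G)) (csC k x) n) :
    φ - liftMap k T n (hatMap k x n φ) ∈
      coboundaries (hochD k (MonoidAlgebra k G)) (csC k x) n := by
  have hD : T.cosetD (coeffMap T φ) = 0 := by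
    rw [← coeffMap_hochD, LinearMap.mem_ker.mp hφ.2]
    rfl
  have hl : liftMap k T n (hatMap k x n φ) ∈ csC k x n := liftMap_mem T (hatMap_mem T hφ.1.1)
  have hc : coeffMap T (liftMap k T n (hatMap k x n φ)) =
      T.inflate (T.restrict (coeffMap T φ)) := by
    rw [liftMap_eq, coeffMap_ofCoeffMap, hatMap_eq T]
  cases n with
  | zero =>
    rw [T.inflate_restrict_zero hD] at hc
    rw [eq_of_coeffMap_eq T hl hφ.1 hc, sub_self]
    exact Submodule.zero_mem _
  | succ n =>
    obtain ⟨E, hE, h⟩ := T.sub_inflate_restrict (vanishesAtOne_coeffMap T hφ.1.1) hD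
    refine ⟨ofCoeffMap T E, ofCoeffMap_mem T hE, eq_of_coeffMap_eq T
      (hochD_mem_csC T (ofCoeffMap_mem T hE)) (Submodule.sub_mem _ hφ.1 hl) ?_⟩
    rw [coeffMap_hochD, coeffMap_ofCoeffMap, ← h, ← hc]
    rfl

end Support

/-! ### Maps in cohomology -/

section Induced

variable {k : Type*} [CommRing k] {M N : ℕ → Type*} [∀ n, AddCommGroup (M n)]
  [∀ n, Module k (M n)] [∀ n, AddCommGroup (N n)] [∀ n, Module k (N n)]
  {d : ∀ n, M n →ₗ[k] M (n + 1)} {C : ∀ n, Submodule k (M n)}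
  {e : ∀ n, N n →ₗ[k] N (n + 1)} {D : ∀ n, Submodule k (N n)}

theorem map_mem_cocycles {α : ∀ n, M n → N n} (h0 : ∀ n, α n 0 = 0)
    (hα : ∀ n, ∀ f ∈ C n, α n f ∈ D n ∧ α (n + 1) (d n f) = e n (α n f)) {n : ℕ} {f : M n}
    (hf : f ∈ cocycles d C n) : α n f ∈ cocycles e D n :=
  ⟨(hα n f hf.1).1, by
    rw [SetLike.mem_coe, LinearMap.mem_ker, ← (hα n f hf.1).2, LinearMap.mem_ker.mp hf.2, h0]⟩

theorem map_mem_coboundaries {α : ∀ n, M n → N n} (h0 : ∀ n, α n 0 = 0)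
    (hα : ∀ n, ∀ f ∈ C n, α n f ∈ D n ∧ α (n + 1) (d n f) = e n (α n f)) {n : ℕ} {f : M n}
    (hf : f ∈ coboundaries d C n) : α n f ∈ coboundaries e D n := by
  cases n with
  | zero =>
    obtain rfl : f = 0 := hf
    rw [h0]
    exact Submodule.zero_mem _
  | succ n =>
    obtain ⟨g, hg, rfl⟩ := hf
    rw [(hα n g hg).2]
    exact ⟨_, (hα n g hg).1, rfl⟩

/-- The map induced in cohomology by a cochain map. -/
def inducedMap (α : ∀ n, M n →ₗ[k] N n)
    (hα : ∀ n, ∀ f ∈ C n, α n f ∈ D n ∧ α (n + 1) (d n f) = e n (α n f)) (n : ℕ) :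
    Cohomology d C n →ₗ[k] Cohomology e D n :=
  Submodule.mapQ _ _
    ((α n).restrict fun _ hf =>
      map_mem_cocycles (α := fun n => α n) (fun n => map_zero (α n)) hα hf)
    fun _ hf => map_mem_coboundaries (α := fun n => α n) (fun n => map_zero (α n)) hα hf

theorem cohomologyClass_eq_iff {n : ℕ} {f g : M n} (hf : f ∈ cocycles d C n)
    (hg : g ∈ cocycles d C n) :
    cohomologyClass d C n f hf = cohomologyClass d C n g hg ↔ f - g ∈ coboundaries d C n :=
  Submodule.Quotient.eq _

theorem cohomologyClass_eq_zero_iff {n : ℕ} {f : M n} (hf : f ∈ cocycles d C n) :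
    cohomologyClass d C n f hf = 0 ↔ f ∈ coboundaries d C n :=
  Submodule.Quotient.mk_eq_zero _

theorem exists_cohomologyClass_eq {n : ℕ} (a : Cohomology d C n) :
    ∃ f hf, cohomologyClass d C n f hf = a := by
  obtain ⟨⟨f, hf⟩, rfl⟩ := Submodule.Quotient.mk_surjective _ a
  exact ⟨f, hf, rfl⟩

theorem coboundaries_mono {C' : ∀ n, Submodule k (M n)} (h : ∀ n, C n ≤ C' n) (n : ℕ) :
    coboundaries d C n ≤ coboundaries d C' n := by
  cases n with
  | zero => exact le_rfl
  | succ n => exact Submodule.map_mono (h n)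

end Induced

/-! ### The decomposition of the Hochschild complex of a group algebra -/

section Decomposition

theorem not_isConj_of_ne {G : Type*} [Group G] {X : Set G}
    (hX : ∀ g : G, ∃! x : G, x ∈ X ∧ IsConj x g) {x y : X} (h : x ≠ y) :
    ¬ IsConj (x : G) y := fun hxy =>
  h (Subtype.ext ((hX y).unique ⟨x.2, hxy⟩ ⟨y.2, IsConj.refl _⟩))

variable {k : Type*} [Field k] {G : Type*} [Group G] [Fintype G]

theorem hatMap_isCochainMap {x : G} (T : RightTransversal (Subgroup.centralizer {x})) (n : ℕ) :
    ∀ φ ∈ hochC k (MonoidAlgebra k G) n,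
      hatMap k x n φ ∈ grpC k (Subgroup.centralizer {x}) n ∧
      hatMap k x (n + 1) (hochD k (MonoidAlgebra k G) n φ) =
        grpD k (Subgroup.centralizer {x}) n (hatMap k x n φ) :=
  fun φ hφ => ⟨hatMap_mem T hφ, hatMap_hochD T φ⟩

theorem liftMap_isCochainMap {x : G} (T : RightTransversal (Subgroup.centralizer {x})) (n : ℕ) :
    ∀ c ∈ grpC k (Subgroup.centralizer {x}) n,
      liftMap k T n c ∈ csC k x n ∧
      liftMap k T (n + 1) (grpD k (Subgroup.centralizer {x}) n c) =
        hochD k (MonoidAlgebra k G) n (liftMap k T n c) :=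
  fun _ hc => ⟨liftMap_mem T hc, liftMap_grpD T hc⟩

/-- Injectivity on cohomology: φ is the sum of φ − lift(φ̂), a coboundary by the homotopy, and
lift(φ̂), the image of a coboundary. -/
theorem mem_coboundaries_of_hatMap {x : G} (T : RightTransversal (Subgroup.centralizer {x}))
    {n : ℕ} {φ : MultilinearMap k (fun _ : Fin n => MonoidAlgebra k G) (MonoidAlgebra k G)}
    (hφ : φ ∈ cocycles (hochD k (MonoidAlgebra k G)) (csC k x) n)
    (h : hatMap k x n φ ∈ coboundaries (grpD k (Subgroup.centralizer {x}))
      (grpC k (Subgroup.centralizer {x})) n) :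
    φ ∈ coboundaries (hochD k (MonoidAlgebra k G)) (csC k x) n := by
  have h1 := map_mem_coboundaries (α := fun n => liftMap k T n) (liftMap_zero T)
    (liftMap_isCochainMap T) h
  simpa using Submodule.add_mem _ (sub_liftMap_hatMap_mem T hφ) h1

theorem exists_csH_equiv {x : G} (T : RightTransversal (Subgroup.centralizer {x})) (n : ℕ) :
    ∃ Ψ : CSH k x n ≃ₗ[k] GrpH k (Subgroup.centralizer {x}) n,
      (∀ φ, ∀ hφ : φ ∈ cocycles (hochD k (MonoidAlgebra k G)) (csC k x) n,
        ∃ hφ' : hatMap k x n φ ∈ cocycles (grpD k (Subgroup.centralizer {x}))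
            (grpC k (Subgroup.centralizer {x})) n,
          Ψ (cohomologyClass _ _ n φ hφ) = cohomologyClass _ _ n _ hφ') ∧
      (∀ c, ∀ hc : c ∈ cocycles (grpD k (Subgroup.centralizer {x}))
            (grpC k (Subgroup.centralizer {x})) n,
        ∃ hc' : liftMap k T n c ∈ cocycles (hochD k (MonoidAlgebra k G)) (csC k x) n,
          Ψ.symm (cohomologyClass _ _ n c hc) = cohomologyClass _ _ n _ hc') := by
  have hlift (c) (hc : c ∈ cocycles (grpD k (Subgroup.centralizer {x}))
      (grpC k (Subgroup.centralizer {x})) n) :=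
    map_mem_cocycles (α := fun n => liftMap k T n) (liftMap_zero T) (liftMap_isCochainMap T) hc
  let A := inducedMap (hatMap k x) (fun n φ (hφ : φ ∈ csC k x n) =>
    hatMap_isCochainMap T n φ hφ.1) n
  have hA (c) (hc) : A (cohomologyClass _ _ n _ (hlift c hc)) = cohomologyClass _ _ n c hc := by
    refine (cohomologyClass_eq_iff _ _).mpr ?_
    simp [hatMap_liftMap]
  have hbij : Function.Bijective A := by
    refine ⟨(injective_iff_map_eq_zero A).mpr fun a ha => ?_, fun b => ?_⟩
    · obtain ⟨φ, hφ, rfl⟩ := exists_cohomologyClass_eq a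
      exact (cohomologyClass_eq_zero_iff _).mpr (mem_coboundaries_of_hatMap T hφ
        ((cohomologyClass_eq_zero_iff _).mp ha))
    · obtain ⟨c, hc, rfl⟩ := exists_cohomologyClass_eq b
      exact ⟨_, hA c hc⟩
  refine ⟨LinearEquiv.ofBijective A hbij, fun φ hφ => ⟨_, rfl⟩, fun c hc => ⟨hlift c hc, ?_⟩⟩
  rw [LinearEquiv.symm_apply_eq]
  exact (hA c hc).symm

variable {X : Set G}

/-- Each summand keeps exactly the coordinates y in one conjugacy class, and the classes partition
G. -/
theorem sum_ofCoeffMap_coeffMap [Fintype X] (hX : ∀ g : G, ∃! x : G, x ∈ X ∧ IsConj x g)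
    (T : ∀ x : X, RightTransversal (Subgroup.centralizer {(x : G)})) {n : ℕ}
    (φ : MultilinearMap k (fun _ : Fin n => MonoidAlgebra k G) (MonoidAlgebra k G)) :
    ∑ x : X, ofCoeffMap (T x) (coeffMap (T x) φ) = φ := by
  classical
  refine ext_coeff fun y g => ?_
  obtain ⟨x, ⟨hxX, hxy⟩, huniq⟩ := hX y
  rw [sum_apply, MonoidAlgebra.coeff_sum, Finsupp.finsetSum_apply,
    Finset.sum_eq_single ⟨x, hxX⟩]
  · obtain ⟨s, rfl⟩ := (T ⟨x, hxX⟩).exists_conj_eq hxy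
    exact congrFun (congrFun (coeffMap_ofCoeffMap (T ⟨x, hxX⟩) (coeffMap (T ⟨x, hxX⟩) φ)) s) g
  · intro z _ hz
    have (s : Fin ((T z).m + 1)) : (T z).conj s ≠ y := fun h =>
      hz (Subtype.ext (huniq z ⟨z.2, h ▸ (T z).isConj_conj s⟩))
    simp [ofCoeffMap, extend_ofTuple, MonoidAlgebra.coeff_sum, this]
  · simp

theorem iSup_csC (hX : ∀ g : G, ∃! x : G, x ∈ X ∧ IsConj x g)
    (T : ∀ x : X, RightTransversal (Subgroup.centralizer {(x : G)})) (n : ℕ) :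
    ⨆ x : X, csC k (x : G) n = hochC k (MonoidAlgebra k G) n := by
  have := Fintype.ofFinite X
  refine le_antisymm (iSup_le fun x φ hφ => hφ.1) fun φ hφ => ?_
  rw [← sum_ofCoeffMap_coeffMap hX T φ]
  exact Submodule.sum_mem _ fun x _ => Submodule.mem_iSup_of_mem x
    (ofCoeffMap_mem (T x) (vanishesAtOne_coeffMap (T x) hφ))

theorem iSupIndep_csC (hX : ∀ g : G, ∃! x : G, x ∈ X ∧ IsConj x g)
    (T : ∀ x : X, RightTransversal (Subgroup.centralizer {(x : G)})) (n : ℕ) :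
    iSupIndep (fun x : X => csC k (x : G) n) := by
  intro x
  rw [Submodule.disjoint_def]
  intro φ hφ hφ'
  have h : coeffMap (T x) φ = 0 := by
    refine Submodule.iSup_induction _ (motive := fun φ => coeffMap (T x) φ = 0) hφ'
      (fun y ψ hψ => ?_) rfl fun ψ χ hψ hχ => ?_
    · by_cases hyx : y = x
      · simp only [hyx, ne_eq, not_true_eq_false, iSup_false, Submodule.mem_bot] at hψ
        rw [hψ]
        rfl
      · simp only [ne_eq, hyx, not_false_eq_true, iSup_pos] at hψ
        exact coeffMap_eq_zero (T x) (not_isConj_of_ne hX hyx) hψ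
    · have : coeffMap (T x) (ψ + χ) = coeffMap (T x) ψ + coeffMap (T x) χ := by
        funext s g
        simp [coeffMap]
      rw [this, hψ, hχ, add_zero]
  exact eq_of_coeffMap_eq (T x) hφ (Submodule.zero_mem _) h

theorem isCochainComplex_hochC (hX : ∀ g : G, ∃! x : G, x ∈ X ∧ IsConj x g)
    (T : ∀ x : X, RightTransversal (Subgroup.centralizer {(x : G)})) :
    IsCochainComplex (hochD k (MonoidAlgebra k G)) (hochC k (MonoidAlgebra k G)) := by
  intro n φ hφ
  rw [← iSup_csC hX T] at hφ
  refine Submodule.iSup_induction _ (motive := fun φ => hochD k (MonoidAlgebra k G) n φ ∈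
      hochC k (MonoidAlgebra k G) (n + 1) ∧
      hochD k (MonoidAlgebra k G) (n + 1) (hochD k (MonoidAlgebra k G) n φ) = 0) hφ
    (fun x ψ hψ => ?_) ?_ fun ψ χ hψ hχ => ?_
  · exact ⟨((isCochainComplex_csC (T x)) n ψ hψ).1.1, ((isCochainComplex_csC (T x)) n ψ hψ).2⟩
  · simp
  · simp only [map_add]
    exact ⟨Submodule.add_mem _ hψ.1 hχ.1, by rw [hψ.2, hχ.2, add_zero]⟩

omit [Fintype G] in
theorem hatMap_eq_zero {x z : G} (T : RightTransversal (Subgroup.centralizer {x}))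
    (hz : ¬ IsConj z x) {n : ℕ}
    {φ : MultilinearMap k (fun _ : Fin n => MonoidAlgebra k G) (MonoidAlgebra k G)}
    (hφ : φ ∈ csC k z n) : hatMap k x n φ = 0 := by
  rw [hatMap_eq T, coeffMap_eq_zero T hz hφ]
  rfl

/-- Each class component of φ is again a cocycle and has the same image under (a) at x as φ, so the
one-class statement applies to it. -/
theorem mem_coboundaries_of_forall_hatMap (hX : ∀ g : G, ∃! x : G, x ∈ X ∧ IsConj x g)
    (T : ∀ x : X, RightTransversal (Subgroup.centralizer {(x : G)})) {n : ℕ}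
    {φ : MultilinearMap k (fun _ : Fin n => MonoidAlgebra k G) (MonoidAlgebra k G)}
    (hφ : φ ∈ cocycles (hochD k (MonoidAlgebra k G)) (hochC k (MonoidAlgebra k G)) n)
    (h : ∀ x : X, hatMap k (x : G) n φ ∈ coboundaries (grpD k (Subgroup.centralizer {(x : G)}))
      (grpC k (Subgroup.centralizer {(x : G)})) n) :
    φ ∈ coboundaries (hochD k (MonoidAlgebra k G)) (hochC k (MonoidAlgebra k G)) n := by
  have := Fintype.ofFinite X
  rw [← sum_ofCoeffMap_coeffMap hX T φ]
  refine Submodule.sum_mem _ fun x _ =>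
    coboundaries_mono (fun n ψ (hψ : ψ ∈ csC k (x : G) n) => hψ.1) n
      (mem_coboundaries_of_hatMap (T x) ⟨?_, ?_⟩ ?_)
  · exact ofCoeffMap_mem (T x) (vanishesAtOne_coeffMap (T x) hφ.1)
  · have hv := vanishesAtOne_coeffMap (T x) hφ.1
    rw [SetLike.mem_coe, LinearMap.mem_ker, hochD_ofCoeffMap (T x) hv, ← coeffMap_hochD,
      LinearMap.mem_ker.mp hφ.2]
    refine eq_of_coeffMap_eq (T x) (ofCoeffMap_mem (T x) fun _ _ _ _ => rfl)
      (Submodule.zero_mem _) (coeffMap_ofCoeffMap (T x) _)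
  · rw [hatMap_eq (T x), coeffMap_ofCoeffMap, ← hatMap_eq (T x)]
    exact h x

theorem exists_HH_equiv [DecidableEq X] (hX : ∀ g : G, ∃! x : G, x ∈ X ∧ IsConj x g)
    (T : ∀ x : X, RightTransversal (Subgroup.centralizer {(x : G)})) (n : ℕ) :
    ∃ Φ : HH k (MonoidAlgebra k G) n ≃ₗ[k]
        ⨁ x : X, GrpH k (Subgroup.centralizer {(x : G)}) n,
      (∀ (x : X) (φ), φ ∈ csC k (x : G) n →
        ∀ hφ : φ ∈ cocycles (hochD k (MonoidAlgebra k G)) (hochC k (MonoidAlgebra k G)) n,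
        ∃ hφ' : hatMap k (x : G) n φ ∈ cocycles (grpD k (Subgroup.centralizer {(x : G)}))
            (grpC k (Subgroup.centralizer {(x : G)})) n,
          Φ (cohomologyClass _ _ n φ hφ) =
            DirectSum.lof k X (fun x : X => GrpH k (Subgroup.centralizer {(x : G)}) n) x
              (cohomologyClass _ _ n _ hφ')) ∧
      (∀ (x : X) (c), ∀ hc : c ∈ cocycles (grpD k (Subgroup.centralizer {(x : G)}))
            (grpC k (Subgroup.centralizer {(x : G)})) n,
        ∃ hc' : liftMap k (T x) n c ∈
            cocycles (hochD k (MonoidAlgebra k G)) (hochC k (MonoidAlgebra k G)) n,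
          liftMap k (T x) n c ∈ csC k (x : G) n ∧
          Φ.symm (DirectSum.lof k X
              (fun x : X => GrpH k (Subgroup.centralizer {(x : G)}) n) x
              (cohomologyClass _ _ n c hc)) =
            cohomologyClass _ _ n _ hc') := by
  have := Fintype.ofFinite X
  -- Map (a) is a cochain map on all normalized cochains, so it acts on HHⁿ without first projecting
  -- to a class.
  let A (x : X) := inducedMap (hatMap k (x : G)) (hatMap_isCochainMap (k := k) (T x)) n
  have hA (x : X) (φ) (hcs : φ ∈ csC k (x : G) n)
      (hφ : φ ∈ cocycles (hochD k (MonoidAlgebra k G)) (hochC k (MonoidAlgebra k G)) n) :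
      LinearMap.pi A (cohomologyClass _ _ n φ hφ) =
        Pi.single x (A x (cohomologyClass _ _ n φ hφ)) := by
    funext y
    by_cases hxy : x = y
    · subst hxy
      simp
    · rw [Pi.single_eq_of_ne (Ne.symm hxy)]
      refine (cohomologyClass_eq_zero_iff _).mpr ?_
      convert Submodule.zero_mem _
      exact hatMap_eq_zero (T y) (not_isConj_of_ne hX hxy) hcs
  have hlift (x : X) (c) (hc : c ∈ cocycles (grpD k (Subgroup.centralizer {(x : G)}))
      (grpC k (Subgroup.centralizer {(x : G)})) n) :
      liftMap k (T x) n c ∈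
        cocycles (hochD k (MonoidAlgebra k G)) (hochC k (MonoidAlgebra k G)) n :=
    map_mem_cocycles (α := fun n => liftMap k (T x) n) (liftMap_zero (T x))
      (fun n c hc => ⟨(liftMap_mem (T x) hc).1, liftMap_grpD (T x) hc⟩) hc
  have hAlift (x : X) (c) (hc) : LinearMap.pi A (cohomologyClass _ _ n _ (hlift x c hc)) =
      Pi.single x (cohomologyClass _ _ n c hc) := by
    rw [hA x _ (liftMap_mem (T x) hc.1)]
    congr 1
    refine (cohomologyClass_eq_iff _ _).mpr ?_
    simp [hatMap_liftMap]
  have hbij : Function.Bijective (LinearMap.pi A) := by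
    refine ⟨(injective_iff_map_eq_zero (LinearMap.pi A)).mpr fun a ha => ?_, fun b => ?_⟩
    · obtain ⟨φ, hφ, rfl⟩ := exists_cohomologyClass_eq a
      exact (cohomologyClass_eq_zero_iff _).mpr (mem_coboundaries_of_forall_hatMap hX T hφ
        fun x => (cohomologyClass_eq_zero_iff _).mp (congrFun ha x))
    · choose c hc hcb using fun x => exists_cohomologyClass_eq (b x)
      refine ⟨∑ x, cohomologyClass _ _ n _ (hlift x (c x) (hc x)), ?_⟩
      rw [map_sum, Finset.sum_congr rfl fun x _ => (hAlift x (c x) (hc x)).trans (by rw [hcb])]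
      exact Finset.univ_sum_single b
  let e := DirectSum.linearEquivFunOnFintype k X
    (fun x : X => GrpH k (Subgroup.centralizer {(x : G)}) n)
  refine ⟨(LinearEquiv.ofBijective (LinearMap.pi A) hbij).trans e.symm, fun x φ hcs hφ => ?_,
    fun x c hc => ⟨hlift x c hc, liftMap_mem (T x) hc.1, ?_⟩⟩
  · refine ⟨map_mem_cocycles (α := fun n => hatMap k (x : G) n) (fun n => map_zero _)
      (hatMap_isCochainMap (T x)) hφ, ?_⟩
    rw [LinearEquiv.trans_apply, LinearEquiv.symm_apply_eq, LinearEquiv.ofBijective_apply,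
      hA x φ hcs, DirectSum.linearEquivFunOnFintype_lof]
    rfl
  · rw [LinearEquiv.symm_apply_eq, LinearEquiv.trans_apply, LinearEquiv.eq_symm_apply,
      LinearEquiv.ofBijective_apply, hAlift, DirectSum.linearEquivFunOnFintype_lof]

end Decomposition

end GroupHH

theorem mainTheorem2 {k : Type*} [Field k] {G : Type*} [Group G] [Fintype G] [DecidableEq G]
    (X : Set G) (hX : ∀ g : G, ∃! x : G, x ∈ X ∧ IsConj x g)
    (T : ∀ x : X, RightTransversal (Subgroup.centralizer {(x : G)})) :
    -- the complexes and the decomposition of the Hochschild complex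
    IsCochainComplex (hochD k (MonoidAlgebra k G)) (hochC k (MonoidAlgebra k G)) ∧
    (∀ x : X, IsCochainComplex (hochD k (MonoidAlgebra k G)) (csC k (x : G)) ∧
      IsCochainComplex (grpD k (Subgroup.centralizer {(x : G)}))
        (grpC k (Subgroup.centralizer {(x : G)}))) ∧
    (∀ n : ℕ, iSupIndep (fun x : X => csC k (x : G) n) ∧
      ⨆ x : X, csC k (x : G) n = hochC k (MonoidAlgebra k G) n) ∧
    -- the two correspondences are cochain maps between `H_x^*` and the complex of `C_G(x)`
    (∀ (x : X) (n : ℕ),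
      (∀ φ ∈ csC k (x : G) n,
        hatMap k (x : G) n φ ∈ grpC k (Subgroup.centralizer {(x : G)}) n ∧
        hatMap k (x : G) (n + 1) (hochD k (MonoidAlgebra k G) n φ) =
          grpD k (Subgroup.centralizer {(x : G)}) n (hatMap k (x : G) n φ)) ∧
      (∀ c ∈ grpC k (Subgroup.centralizer {(x : G)}) n,
        liftMap k (T x) n c ∈ csC k (x : G) n ∧
        liftMap k (T x) (n + 1) (grpD k (Subgroup.centralizer {(x : G)}) n c) =
          hochD k (MonoidAlgebra k G) n (liftMap k (T x) n c))) ∧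
    -- they induce mutually inverse isomorphisms `Hⁿ(H_x^*) ≃ Hⁿ(C_G(x), k)`
    (∀ (x : X) (n : ℕ),
      ∃ Ψ : CSH k (x : G) n ≃ₗ[k] GrpH k (Subgroup.centralizer {(x : G)}) n,
        (∀ φ, ∀ hφ : φ ∈ cocycles (hochD k (MonoidAlgebra k G)) (csC k (x : G)) n,
          ∃ hφ' : hatMap k (x : G) n φ ∈ cocycles (grpD k (Subgroup.centralizer {(x : G)}))
              (grpC k (Subgroup.centralizer {(x : G)})) n,
            Ψ (cohomologyClass _ _ n φ hφ) = cohomologyClass _ _ n _ hφ') ∧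
        (∀ c, ∀ hc : c ∈ cocycles (grpD k (Subgroup.centralizer {(x : G)}))
              (grpC k (Subgroup.centralizer {(x : G)})) n,
          ∃ hc' : liftMap k (T x) n c ∈
              cocycles (hochD k (MonoidAlgebra k G)) (csC k (x : G)) n,
            Ψ.symm (cohomologyClass _ _ n c hc) = cohomologyClass _ _ n _ hc')) ∧
    -- together they give `HHⁿ(kG) ≃ ⨁ₓ Hⁿ(C_G(x), k)` and its inverse
    (∀ n : ℕ,
      ∃ Φ : HH k (MonoidAlgebra k G) n ≃ₗ[k]
          ⨁ x : X, GrpH k (Subgroup.centralizer {(x : G)}) n,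
        (∀ (x : X) (φ), φ ∈ csC k (x : G) n →
          ∀ hφ : φ ∈ cocycles (hochD k (MonoidAlgebra k G)) (hochC k (MonoidAlgebra k G)) n,
          ∃ hφ' : hatMap k (x : G) n φ ∈ cocycles (grpD k (Subgroup.centralizer {(x : G)}))
              (grpC k (Subgroup.centralizer {(x : G)})) n,
            Φ (cohomologyClass _ _ n φ hφ) =
              DirectSum.lof k X (fun x : X => GrpH k (Subgroup.centralizer {(x : G)}) n) x
                (cohomologyClass _ _ n _ hφ')) ∧
        (∀ (x : X) (c), ∀ hc : c ∈ cocycles (grpD k (Subgroup.centralizer {(x : G)}))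
              (grpC k (Subgroup.centralizer {(x : G)})) n,
          ∃ hc' : liftMap k (T x) n c ∈
              cocycles (hochD k (MonoidAlgebra k G)) (hochC k (MonoidAlgebra k G)) n,
            liftMap k (T x) n c ∈ csC k (x : G) n ∧
            Φ.symm (DirectSum.lof k X
                (fun x : X => GrpH k (Subgroup.centralizer {(x : G)}) n) x
                (cohomologyClass _ _ n c hc)) =
              cohomologyClass _ _ n _ hc')) := by
  refine ⟨isCochainComplex_hochC hX T, fun x => ⟨isCochainComplex_csC (T x), isCochainComplex_grp⟩,
    fun n => ⟨iSupIndep_csC hX T n, iSup_csC hX T n⟩,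
    fun x n => ⟨fun φ hφ => hatMap_isCochainMap (T x) n φ hφ.1, liftMap_isCochainMap (T x) n⟩,
    fun x n => exists_csH_equiv (T x) n, fun n => exists_HH_equiv hX T n⟩
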